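/- Let $\mathcal X$ be a separable Banach manifold of class $C^k$, $k\ge 1$ (or smooth, or analytic), modelled on a real Banach space $E$, and let $\mathcal H$ be a real Banach space. For each $q\in\mathcal X$ let $\langle\cdot,\cdot\rangle_q$ be an inner product on $\mathcal H$ whose norm is equivalent to the norm of $\mathcal H$, and suppose that $q\mapsto\langle\cdot,\cdot\rangle_q$ is Fréchet differentiable as a map into the bounded bilinear forms on $\mathcal H$. For each $q\in\mathcal X$ let $A(q)$ be a linear operator in $\mathcal H$ such that: (i) all the $A(q)$ have the same domain $\mathcal D$, a dense linear subspace of $\mathcal H$, and $A(q)$ is self-adjoint with respect to $\langle\cdot,\cdot\rangle_q$; (ii) the spectrum of each $A(q)$ consists of eigenvalues of finite multiplicity and has no finite accumulation point; (iii) the resolvents depend Fréchet-differentiably on $q$: if $\mu\in\mathbb R$ is in the resolvent set of $A(q_0)$, then $\mu$ is in the resolvent set of $A(q)$ for all $q$ near $q_0$, and $q\mapsto R_\mu(q)=(\mu-A(q))^{-1}$, as a map into the bounded operators on $\mathcal H$, is Fréchet differentiable at $q_0$; (iv) (condition SAH2) for every $q\in\mathcal X$ and every eigenvalue $\lambda$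 of $A(q)$ of multiplicity at least $2$ there are two eigenvectors $v_1,v_2$ of $A(q)$ with eigenvalue $\lambda$, orthonormal for $\langle\cdot,\cdot\rangle_q$, and a real number $\mu$ in the resolvent set of $A(q)$, such that the linear functionals $f'_{11}-f'_{22}$ and $f'_{12}$ on $T_q\mathcal X$ are linearly independent, where $f'_{ij}(h)=\langle R_\mu'(q)[h]\,v_i,v_j\rangle_q$. Then the set of all $q\in\mathcal X$ such that $A(q)$ has a repeated eigenvalue (an eigenvalue of multiplicity at least $2$) has meagre codimension $2$ in $\mathcal X$. Here a subset $Y$ of a Banach manifold $\mathcal X$ modelled on $E$ has meagre codimension $n\ge 1$ if for every chart $(\phi,U)$ of $\mathcal X$, every closed linear subspace $Z\subset E$ of codimension $n-1$ and every nonlinear projection $\pi:\phi(U)\to Z$, the set $\pi(\phi(U\cap Y))$ is meagre in $Z$; a nonlinear projection $\pi:\phi(U)\to Z$ is a Fréchet differentiable map such that, for all $x\in\phi(U)$, the derivative $\pi'_x:E\to Z$ is onto and $\dim\ker\pi'_x=n-1$. -/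

import Mathlib

open Set Filter Topology
open scoped Manifold ContDiff

noncomputable section

namespace MeagreCodim

section Codimension

variable {E : Type*} [NormedAddCommGroup E] [NormedSpace ℝ E]

/-- `π` is a nonlinear projection of codimension `n` from the open set `Ω` of the Banach space `E`
onto the closed linear subspace `Z` of `E`: the subspace `Z` has codimension `n`, and at every point
of `Ω` the map `π` is Fréchet differentiable, its derivative is onto, and the kernel of the
derivative has dimension `n`.  The values of `π` off `Ω` play no role. -/
structure IsNonlinearProjection (Ω : Set E) (Z : Submodule ℝ E) (n : ℕ) (π : E → Z) : Prop where
  isClosed : IsClosed (Z : Set E)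
  codim : Module.rank ℝ (E ⧸ Z) = n
  differentiableAt : ∀ x ∈ Ω, DifferentiableAt ℝ π x
  surjective : ∀ x ∈ Ω, Function.Surjective (fderiv ℝ π x)
  rank_ker : ∀ x ∈ Ω, Module.rank ℝ (LinearMap.ker (fderiv ℝ π x : E →ₗ[ℝ] Z)) = n

/-- The subset `Y` of the open set `Ω ⊆ E` has meagre codimension `n` in `Ω` (for `n ≥ 1`): its image
under every nonlinear projection of codimension `n - 1` is meagre in the target subspace. -/
def HasMeagreCodimIn (Ω Y : Set E) (n : ℕ) : Prop :=
  ∀ m : ℕ, m + 1 = n → ∀ (Z : Submodule ℝ E) (π : E → Z),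
    IsNonlinearProjection Ω Z m π → IsMeagre (π '' Y)

/-- A subset `Y` of a `C^k` Banach manifold `X` modelled on `E` has meagre codimension `n` if in every
chart `φ` (every member of the maximal `C^k` atlas) the set `φ (U ∩ Y)` has meagre codimension `n`
in `φ (U)`, where `U` is the domain of `φ`. -/
def HasMeagreCodim (E : Type*) [NormedAddCommGroup E] [NormedSpace ℝ E] (k : WithTop ℕ∞)
    {X : Type*} [TopologicalSpace X] [ChartedSpace E X] (Y : Set X) (n : ℕ) : Prop :=
  ∀ φ ∈ IsManifold.maximalAtlas 𝓘(ℝ, E) k X,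
    HasMeagreCodimIn φ.target (φ '' (φ.source ∩ Y)) n

end Codimension

section Operators

variable {H : Type*} [NormedAddCommGroup H] [NormedSpace ℝ H]

/-- The continuous bilinear form `g` is an inner product on `H` inducing a norm equivalent to the
given one.  (The bound `g v v ≤ C * ‖v‖ ^ 2` is the continuity of `g`.) -/
structure IsEquivInner (g : H →L[ℝ] H →L[ℝ] ℝ) : Prop where
  symm : ∀ v w, g v w = g w v
  coercive : ∃ c : ℝ, 0 < c ∧ ∀ v, c * ‖v‖ ^ 2 ≤ g v v

/-- The unbounded operator `A` is densely defined and self-adjoint for the inner product `g`: it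
has the same graph as its adjoint.  The adjoint relates `y` to `z` iff
`⟨A x, y⟩ = ⟨x, z⟩` for all `x` in the domain of `A`. -/
structure IsSelfAdjointFor (g : H →L[ℝ] H →L[ℝ] ℝ) (A : H →ₗ.[ℝ] H) : Prop where
  dense : Dense (A.domain : Set H)
  adjoint_graph : ∀ y z : H,
    (∀ x : A.domain, g (A x) y = g (x : H) z) ↔ (y, z) ∈ A.graph

/-- The bounded operator `R` is a two-sided inverse of `μ - A : A.domain → H`. -/
structure IsResolventOf (A : H →ₗ.[ℝ] H) (μ : ℝ) (R : H →L[ℝ] H) : Prop where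
  left_inv : ∀ x : A.domain, R (μ • (x : H) - A x) = x
  mem_domain : ∀ y, R y ∈ A.domain
  right_inv : ∀ y, μ • R y - A ⟨R y, mem_domain y⟩ = y

/-- The resolvent set of `A` (its real points; the spectrum of a self-adjoint operator is real). -/
def resolventSet (A : H →ₗ.[ℝ] H) : Set ℝ := {μ | ∃ R, IsResolventOf A μ R}

/-- The spectrum of `A`. -/
def spectrum (A : H →ₗ.[ℝ] H) : Set ℝ := (resolventSet A)ᶜ

open Classical in
/-- The resolvent `(μ - A)⁻¹`, for `μ` in the resolvent set (and `0` otherwise). -/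
def resolvent (A : H →ₗ.[ℝ] H) (μ : ℝ) : H →L[ℝ] H :=
  if h : μ ∈ resolventSet A then h.choose else 0

/-- The eigenspace `{x ∈ dom A | A x = l x}`. -/
def eigenspace (A : H →ₗ.[ℝ] H) (l : ℝ) : Submodule ℝ H where
  carrier := {x | (x, l • x) ∈ A.graph}
  add_mem' {x y} hx hy := by
    simpa [smul_add] using A.graph.add_mem hx hy
  zero_mem' := by
    change ((0 : H), l • (0 : H)) ∈ A.graph
    rw [smul_zero]
    exact A.graph.zero_mem
  smul_mem' c x hx := by
    simpa [smul_comm c l x] using A.graph.smul_mem c hx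

/-- The spectrum of `A` is discrete and of finite multiplicity: it consists of eigenvalues with
finite-dimensional eigenspaces and it has no accumulation point in `ℝ`. -/
structure HasDiscreteSpectrum (A : H →ₗ.[ℝ] H) : Prop where
  eigenvalue : ∀ l ∈ spectrum A, eigenspace A l ≠ ⊥
  finite_mult : ∀ l ∈ spectrum A, FiniteDimensional ℝ (eigenspace A l)
  no_accPt : ∀ x : ℝ, ¬ AccPt x (𝓟 (spectrum A))

/-- `A` has a repeated eigenvalue, i.e. an eigenvalue of multiplicity at least `2`. -/
def HasRepeatedEigenvalue (A : H →ₗ.[ℝ] H) : Prop :=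
  ∃ l : ℝ, 2 ≤ Module.rank ℝ (eigenspace A l)

end Operators

section Families

variable {E : Type*} [NormedAddCommGroup E] [NormedSpace ℝ E]
  {X : Type*} [TopologicalSpace X] [ChartedSpace E X]
  {H : Type*} [NormedAddCommGroup H] [NormedSpace ℝ H]

variable (E) in
/-- The resolvents of the family `A` depend Fréchet-differentiably on the parameter: whenever `μ` is
in the resolvent set of `A q`, it is in that of `A p` for all `p` near `q`, and the map
`p ↦ (μ - A p)⁻¹` into the bounded operators is differentiable at `q`. -/
def ResolventsDifferentiable (A : X → H →ₗ.[ℝ] H) : Prop :=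
  ∀ (q : X) (μ : ℝ), μ ∈ resolventSet (A q) →
    (∀ᶠ p in 𝓝 q, μ ∈ resolventSet (A p)) ∧
    MDifferentiableAt 𝓘(ℝ, E) 𝓘(ℝ, H →L[ℝ] H) (fun p => resolvent (A p) μ) q

variable (E) in
/-- The derivative at `q` of `p ↦ (μ - A p)⁻¹`, as a map from the tangent space at `q` to the
bounded operators. -/
def resolventDeriv (A : X → H →ₗ.[ℝ] H) (μ : ℝ) (q : X) :
    TangentSpace 𝓘(ℝ, E) q →L[ℝ] (H →L[ℝ] H) :=
  mfderiv 𝓘(ℝ, E) 𝓘(ℝ, H →L[ℝ] H) (fun p => resolvent (A p) μ) q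

variable (E) in
/-- The linear functional `h ↦ ⟨R'(q)[h] v, w⟩_q` on the tangent space at `q`, where
`R(p) = (μ - A p)⁻¹`. -/
def derivEntry (g : X → H →L[ℝ] H →L[ℝ] ℝ) (A : X → H →ₗ.[ℝ] H) (μ : ℝ) (q : X) (v w : H) :
    TangentSpace 𝓘(ℝ, E) q →ₗ[ℝ] ℝ where
  toFun h := g q (resolventDeriv E A μ q h v) w
  map_add' h h' := by simp
  map_smul' c h := by simp

variable (E) in
/-- The condition SAH2: for every parameter `q` and every eigenvalue `l` of `A q` of multiplicity at
least `2` there are two eigenvectors `v₁, v₂` for `l`, orthonormal for the inner product at `q`, such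
that the functionals `f'₁₁ - f'₂₂` and `f'₁₂` on the tangent space at `q` are linearly independent,
where `f'ᵢⱼ(h) = ⟨R'(q)[h] vᵢ, vⱼ⟩_q` for some resolvent `R(p) = (μ - A p)⁻¹`. -/
def SAH2 (g : X → H →L[ℝ] H →L[ℝ] ℝ) (A : X → H →ₗ.[ℝ] H) : Prop :=
  ∀ (q : X) (l : ℝ), 2 ≤ Module.rank ℝ (eigenspace (A q) l) →
    ∃ μ ∈ resolventSet (A q), ∃ v₁ ∈ eigenspace (A q) l, ∃ v₂ ∈ eigenspace (A q) l,
      g q v₁ v₁ = 1 ∧ g q v₂ v₂ = 1 ∧ g q v₁ v₂ = 0 ∧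
      LinearIndependent ℝ
        ![derivEntry E g A μ q v₁ v₁ - derivEntry E g A μ q v₂ v₂, derivEntry E g A μ q v₁ v₂]

end Families

end MeagreCodim

end

/-! Analytic half: let `l` be a repeated eigenvalue of `A q`, with `v₁`, `v₂` and `μ` as in SAH2. If
`A q'` has an eigenvalue near `l` of the same multiplicity, every eigenvector of `A q` for `l` is
close to one of `A q'`. Then the compression of the difference of the two resolvents to `v₁, v₂` is
scalar up to a quadratic error (`exists_bound_resolvent`). So in a chart the parameters with such a
persisting eigenvalue are tangent at the base point to the common kernel of the two functionals of
SAH2, a subspace of codimension two (`exists_tangency`). Prescribing the multiplicity and a rational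
interval for the eigenvalue gives countably many sets `W`; each parameter with a repeated eigenvalue
lies in one that is tangent there in this sense.

Geometric half (`isMeagre_image_of_tangency`): let `D` be the derivative of the projection, with
kernel spanned by `e`, and let `ker L` be the tangent subspace of codimension two. If `e` is not in
`ker L`, then `D (ker L)` is a hyperplane; a transverse direction `u` is then never realised by two
nearby points, and the image is nowhere dense. If `e` is in `ker L`, then `D (ker L)` has
codimension two and misses a plane. Points whose images differ by nearly a vector of that plane
differ by nearly a multiple of `e`, so a functional `τ` with `τ e ≠ 0` separates them. Over an `M ×
M` grid in the plane this needs `M ^ 2` values of the bounded function `τ` at mutual distance of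
order `1 / M`, which is impossible for large `M`. Countably many choices of constants and directions
cover everything. -/

namespace MeagreCodim

/-! ### Nowhere dense images: a two-point argument and a grid count. -/

section Geometry

variable {E : Type*} [NormedAddCommGroup E]
  {Z : Type*} [NormedAddCommGroup Z] [NormedSpace ℝ Z]

/-- A set `P` whose points cannot be joined, up to a small relative error, in the direction `u` as
seen through `f` has a nowhere dense image under `f`. -/
theorem isNowhereDense_image_of_line {P : Set E} {f : E → Z} {u : Z} (hu : u ≠ 0)
    {C ε : ℝ} (hC : 0 < C) (hε : 0 < ε)
    (hlip : ∀ x ∈ P, ∀ y ∈ P, ‖f y - f x‖ ≤ C * ‖y - x‖)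
    (hline : ∀ x ∈ P, ∀ y ∈ P, ∀ s : ℝ, ‖f y - f x - s • u‖ ≤ ε * ‖y - x‖ → y = x) :
    IsNowhereDense (f '' P) := by
  rw [IsNowhereDense, Set.eq_empty_iff_forall_notMem]
  intro z hz
  obtain ⟨r, hr, hball⟩ := Metric.isOpen_iff.1 isOpen_interior z hz
  have hball' := hball.trans interior_subset
  have hu' : 0 < ‖u‖ := norm_pos_iff.2 hu
  set s : ℝ := r / (2 * ‖u‖) with hs
  have hs0 : 0 < s := by positivity
  have hsu : s * ‖u‖ = r / 2 := by rw [hs]; field_simp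
  -- The images of `x` and `y` will differ by at least `r / 4`, so `‖y - x‖ ≥ r / 4 / C`, and the
  -- error `2 * η` is at most `ε` times this.
  set η : ℝ := min (r / 8) (ε * (r / 4 / C) / 2) with hη
  have hη0 : 0 < η := by positivity
  have h1 : z ∈ closure (f '' P) := hball' (Metric.mem_ball_self hr)
  have h2 : z + s • u ∈ closure (f '' P) := hball' (by
    rw [Metric.mem_ball, dist_eq_norm, add_sub_cancel_left, norm_smul, Real.norm_of_nonneg hs0.le,
      hsu]
    linarith)
  obtain ⟨_, ⟨x, hx, rfl⟩, hxz⟩ := Metric.mem_closure_iff.1 h1 η hη0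
  obtain ⟨_, ⟨y, hy, rfl⟩, hyz⟩ := Metric.mem_closure_iff.1 h2 η hη0
  rw [dist_eq_norm] at hxz hyz
  have hη1 : η ≤ r / 8 := min_le_left _ _
  have hη2 : η ≤ ε * (r / 4 / C) / 2 := min_le_right _ _
  have key : ‖f y - f x - s • u‖ ≤ 2 * η := by
    have : f y - f x - s • u = (z - f x) - (z + s • u - f y) := by abel
    rw [this]
    linarith [norm_sub_le (z - f x) (z + s • u - f y)]
  have hfar : r / 4 ≤ ‖f y - f x‖ := by
    have h3 : ‖s • u‖ ≤ ‖f y - f x‖ + ‖f y - f x - s • u‖ := by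
      have := norm_sub_le (f y - f x) (f y - f x - s • u)
      rwa [sub_sub_cancel] at this
    rw [norm_smul, Real.norm_of_nonneg hs0.le, hsu] at h3
    linarith
  have hxy : r / 4 / C ≤ ‖y - x‖ := by
    rw [div_le_iff₀ hC, mul_comm _ C]
    exact hfar.trans (hlip x hx y hy)
  have heq : y = x := hline x hx y hy s (by
    have := mul_le_mul_of_nonneg_left hxy hε.le
    linarith)
  rw [heq, sub_self, norm_zero] at hfar
  linarith

/-- A set `P` whose points can be joined, up to a small relative error, in a direction of the plane
spanned by `u` and `v` as seen through `f` only if they are well separated by the bounded function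
`τ` has a nowhere dense image under `f`. -/
theorem isNowhereDense_image_of_plane {P : Set E} {f : E → Z} {u v : Z} {c : ℝ} (hc : 0 < c)
    (huv : ∀ s t : ℝ, c * |s| ≤ ‖s • u + t • v‖ ∧ c * |t| ≤ ‖s • u + t • v‖)
    {C ε K : ℝ} (hC : 0 < C) (hε : 0 < ε) (hK : 0 < K) {τ : E → ℝ} (hτ : ∀ x ∈ P, |τ x| ≤ K)
    (hlip : ∀ x ∈ P, ∀ y ∈ P, ‖f y - f x‖ ≤ C * ‖y - x‖)
    (hplane : ∀ x ∈ P, ∀ y ∈ P, ∀ s t : ℝ,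
      ‖f y - f x - (s • u + t • v)‖ ≤ ε * ‖y - x‖ → ‖y - x‖ ≤ C * |τ y - τ x|) :
    IsNowhereDense (f '' P) := by
  rw [IsNowhereDense, Set.eq_empty_iff_forall_notMem]
  intro z hz
  obtain ⟨r, hr, hball⟩ := Metric.isOpen_iff.1 isOpen_interior z hz
  have hball' := hball.trans interior_subset
  set w : ℝ := ‖u‖ + ‖v‖ + 1 with hw
  have hw0 : 0 < w := by positivity
  -- the values of `τ` at the points over an `M × M` grid are separated by `β / M`
  set β : ℝ := c * (r / w) / 2 / C / C with hβ
  have hβ0 : 0 < β := by positivity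
  -- The interval `[-K, K]` has about `2 * K * M / β` slots of length `β / M`, fewer than `M ^ 2`;
  -- the `4` absorbs rounding.
  obtain ⟨M, hM⟩ := exists_nat_gt (2 * K / β + 4)
  have hM4 : (4 : ℝ) < M := by
    have : 0 < 2 * K / β := by positivity
    linarith
  have hM0 : (0 : ℝ) < M := by linarith
  set a : ℝ := r / w / M with ha
  have ha0 : 0 < a := by positivity
  set η : ℝ := min (c * a / 4) (ε * (c * a / 2 / C) / 2) with hη
  have hη0 : 0 < η := by positivity
  have hη1 : η ≤ c * a / 4 := min_le_left _ _
  have hη2 : η ≤ ε * (c * a / 2 / C) / 2 := min_le_right _ _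
  set G : Fin M × Fin M → Z := fun p => (a * (p.1 : ℕ)) • u + (a * (p.2 : ℕ)) • v with hG
  have hsel : ∀ p : Fin M × Fin M, ∃ x ∈ P, ‖z + G p - f x‖ < η := by
    intro p
    have hmem : z + G p ∈ closure (f '' P) := hball' (by
      rw [Metric.mem_ball, dist_eq_norm, add_sub_cancel_left]
      have hi : ∀ i : Fin M, a * ((i : ℕ) : ℝ) ≤ r / w := fun i => by
        have : ((i : ℕ) : ℝ) ≤ M := by exact_mod_cast i.2.le
        calc a * ((i : ℕ) : ℝ) ≤ a * M := by gcongr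
          _ = r / w := by rw [ha]; field_simp
      calc ‖G p‖ ≤ ‖(a * (p.1 : ℕ)) • u‖ + ‖(a * (p.2 : ℕ)) • v‖ := norm_add_le _ _
        _ = a * (p.1 : ℕ) * ‖u‖ + a * (p.2 : ℕ) * ‖v‖ := by
          rw [norm_smul, norm_smul, Real.norm_of_nonneg (by positivity),
            Real.norm_of_nonneg (by positivity)]
        _ ≤ r / w * ‖u‖ + r / w * ‖v‖ := by gcongr <;> apply hi
        _ = r / w * (w - 1) := by rw [hw]; ring
        _ < r / w * w := by gcongr; linarith
        _ = r := by field_simp)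
    obtain ⟨_, ⟨x, hx, rfl⟩, hxz⟩ := Metric.mem_closure_iff.1 hmem η hη0
    exact ⟨x, hx, by rwa [dist_eq_norm] at hxz⟩
  choose x hxP hx using hsel
  have hsep : ∀ p q, p ≠ q → β / M ≤ |τ (x q) - τ (x p)| := by
    intro p q hpq
    set s : ℝ := a * (q.1 : ℕ) - a * (p.1 : ℕ) with hs
    set t : ℝ := a * (q.2 : ℕ) - a * (p.2 : ℕ) with ht
    have hGpq : G q - G p = s • u + t • v := by
      simp only [hG, hs, ht, sub_smul]; abel
    have hnat : ∀ i j : Fin M, i ≠ j → a ≤ |a * ((j : ℕ) : ℝ) - a * ((i : ℕ) : ℝ)| := by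
      intro i j hij
      rw [← mul_sub, abs_mul, abs_of_pos ha0]
      have h1 : (1 : ℤ) ≤ |((j : ℕ) : ℤ) - ((i : ℕ) : ℤ)| := by
        apply Int.one_le_abs
        intro h
        apply hij
        ext
        omega
      have h2 : (1 : ℝ) ≤ |((j : ℕ) : ℝ) - ((i : ℕ) : ℝ)| := by exact_mod_cast h1
      nlinarith
    have hgrid : c * a ≤ ‖s • u + t • v‖ := by
      by_cases h1 : p.1 = q.1
      · have h2 : p.2 ≠ q.2 := fun h => hpq (Prod.ext h1 h)
        exact (mul_le_mul_of_nonneg_left (hnat _ _ h2) hc.le).trans (huv s t).2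
      · exact (mul_le_mul_of_nonneg_left (hnat _ _ h1) hc.le).trans (huv s t).1
    have key : ‖f (x q) - f (x p) - (s • u + t • v)‖ ≤ 2 * η := by
      have : f (x q) - f (x p) - (s • u + t • v)
          = (z + G p - f (x p)) - (z + G q - f (x q)) := by rw [← hGpq]; abel
      rw [this]
      linarith [norm_sub_le (z + G p - f (x p)) (z + G q - f (x q)), hx p, hx q]
    have hfar : c * a / 2 ≤ ‖f (x q) - f (x p)‖ := by
      have h3 := norm_sub_le (f (x q) - f (x p)) (f (x q) - f (x p) - (s • u + t • v))
      rw [sub_sub_cancel] at h3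
      linarith
    have hxy : c * a / 2 / C ≤ ‖x q - x p‖ := by
      rw [div_le_iff₀ hC, mul_comm _ C]
      exact hfar.trans (hlip _ (hxP p) _ (hxP q))
    have h4 := hplane _ (hxP p) _ (hxP q) s t (by
      have := mul_le_mul_of_nonneg_left hxy hε.le
      linarith)
    have h5 : c * a / 2 / C / C ≤ |τ (x q) - τ (x p)| := by
      rw [div_le_iff₀ hC, mul_comm _ C]
      exact hxy.trans h4
    refine le_trans (le_of_eq ?_) h5
    rw [hβ, ha]
    ring
  have hb : 0 < β / M := by positivity
  set N : ℤ := ⌈K / (β / M)⌉ with hN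
  have hmaps : ∀ p ∈ (Finset.univ : Finset (Fin M × Fin M)),
      ⌊τ (x p) / (β / M)⌋ ∈ Finset.Icc (-N) N := by
    intro p _
    have h := abs_le.1 (hτ _ (hxP p))
    rw [Finset.mem_Icc]
    constructor
    · rw [Int.le_floor]
      push_cast
      have h1 : K / (β / M) ≤ N := Int.le_ceil _
      have h2 : -(K / (β / M)) ≤ τ (x p) / (β / M) := by
        rw [← neg_div]; gcongr; exact h.1
      linarith
    · have h1 : K / (β / M) ≤ N := Int.le_ceil _
      have h2 : τ (x p) / (β / M) ≤ K / (β / M) := by gcongr; exact h.2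
      have h3 := Int.floor_le (τ (x p) / (β / M))
      exact_mod_cast h3.trans (h2.trans h1)
  -- Two values in the same slot would be closer than `β / M`.
  have hinj : Set.InjOn (fun p => ⌊τ (x p) / (β / M)⌋)
      ((Finset.univ : Finset (Fin M × Fin M)) : Set (Fin M × Fin M)) := by
    intro p _ q _ hpq
    by_contra hne
    have h1 := Int.abs_sub_lt_one_of_floor_eq_floor hpq.symm
    rw [← sub_div, abs_div, abs_of_pos hb, div_lt_one hb] at h1
    exact absurd (hsep p q hne) (not_le.2 h1)
  have hcard := Finset.card_le_card_of_injOn _ hmaps hinj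
  rw [Finset.card_univ, Fintype.card_prod, Fintype.card_fin, Int.card_Icc] at hcard
  have hN0 : 0 ≤ N := by rw [hN]; positivity
  have hcardZ : ((M : ℤ) * M) ≤ N + 1 - -N := by
    rw [← Int.toNat_of_nonneg (by omega : 0 ≤ N + 1 - -N)]
    exact_mod_cast hcard
  have hcardR : (M : ℝ) * M ≤ 2 * N + 1 := by
    have : ((M : ℤ) * M : ℝ) ≤ ((N + 1 - -N : ℤ) : ℝ) := by exact_mod_cast hcardZ
    push_cast at this
    linarith
  have hNlt : (N : ℝ) < K / (β / M) + 1 := Int.ceil_lt_add_one _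
  have hKM : K / (β / M) = K / β * M := by field_simp
  rw [hKM] at hNlt
  have : (2 * K / β + 4) * M < M * M := by gcongr
  have h6 : (2 * K / β + 4) * M = 2 * (K / β * M) + 4 * M := by ring
  linarith

end Geometry

/-! ### From tangency in codimension two to meagre images. -/

section Tangency

variable {E : Type*} [NormedAddCommGroup E] [NormedSpace ℝ E]
  {Z : Type*} [NormedAddCommGroup Z] [NormedSpace ℝ Z]

/-- On a separable space some countable set of functionals contains `0` and separates points. -/
theorem exists_countable_separating_dual [TopologicalSpace.SeparableSpace E] :
    ∃ T : Set (E →L[ℝ] ℝ), T.Countable ∧ 0 ∈ T ∧ ∀ e : E, e ≠ 0 → ∃ τ ∈ T, τ e ≠ 0 := by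
  choose τ hτ1 hτ2 using fun n : ℕ => exists_dual_vector'' ℝ (TopologicalSpace.denseSeq E n)
  refine ⟨insert 0 (range τ), (countable_range τ).insert 0, mem_insert _ _, fun e he => ?_⟩
  have he' : 0 < ‖e‖ := norm_pos_iff.2 he
  obtain ⟨n, hn⟩ := (TopologicalSpace.denseRange_denseSeq E).exists_dist_lt e
    (half_pos he')
  refine ⟨τ n, mem_insert_of_mem _ ⟨n, rfl⟩, fun h0 => ?_⟩
  set x := TopologicalSpace.denseSeq E n
  rw [dist_eq_norm] at hn
  -- The norming functional of `x` vanishes at `e`, so it takes the value `-‖x‖` at `e - x`; but `x`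
  -- is within `‖e‖ / 2` of `e`.
  have h1 : ‖x‖ ≤ ‖e - x‖ := by
    have h2 : τ n (e - x) = -‖x‖ := by rw [map_sub, h0, hτ2]; simp [x]
    have h3 := (τ n).le_of_opNorm_le (hτ1 n) (e - x)
    rw [h2, norm_neg, norm_norm, one_mul] at h3
    exact h3
  have h4 := norm_sub_norm_le e x
  linarith

/-- A continuous linear map that vanishes on the kernel of a surjection of Banach spaces factors
through it. -/
theorem exists_clm_factor [CompleteSpace E] [CompleteSpace Z]
    {F : Type*} [NormedAddCommGroup F] [NormedSpace ℝ F]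
    (D : E →L[ℝ] Z) (hD : Function.Surjective D) (M : E →L[ℝ] F)
    (hM : ∀ x, D x = 0 → M x = 0) : ∃ G : Z →L[ℝ] F, ∀ x, G (D x) = M x := by
  -- The open mapping theorem gives a bounded right inverse, not necessarily linear; `M ∘ j` is
  -- linear because `M x` depends only on `D x`.
  obtain ⟨j, -⟩ := D.exists_nonlinearRightInverse_of_surjective (LinearMap.range_eq_top.2 hD)
  have hinv : ∀ z, D (j z) = z := j.right_inv
  have hMD : ∀ x y, D x = D y → M x = M y := fun x y h => by
    have := hM (x - y) (by rw [map_sub, h, sub_self])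
    rwa [map_sub, sub_eq_zero] at this
  refine ⟨LinearMap.mkContinuous
    { toFun := fun z => M (j z)
      map_add' := fun z w => by
        rw [← map_add]; apply hMD; rw [map_add, hinv, hinv, hinv]
      map_smul' := fun c z => by
        rw [RingHom.id_apply, ← map_smul]; apply hMD; rw [map_smul, hinv, hinv] }
    (‖M‖ * j.nnnorm) (fun z => ?_), fun x => ?_⟩
  · calc ‖M (j z)‖ ≤ ‖M‖ * ‖j z‖ := M.le_opNorm _
      _ ≤ ‖M‖ * (j.nnnorm * ‖z‖) := by gcongr; exact j.bound z
      _ = ‖M‖ * j.nnnorm * ‖z‖ := by ring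
  · exact hMD _ _ (hinv _)

/-- If `h` is almost killed by `L` and `D h` is almost in the span of `u` and `v`, on which `G` is
bounded below, then `h` is almost in the kernel of `D`. -/
theorem exists_near_ker [CompleteSpace E] [CompleteSpace Z]
    {F F' : Type*} [NormedAddCommGroup F] [NormedSpace ℝ F] [NormedAddCommGroup F']
    [NormedSpace ℝ F'] (D : E →L[ℝ] Z) (hD : Function.Surjective D) (L : E →L[ℝ] F')
    (Λ : F' →L[ℝ] F) (G : Z →L[ℝ] F) (hG : ∀ x, G (D x) = Λ (L x)) {u v : Z} {K : ℝ} (hK : 0 ≤ K)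
    (huv : ∀ s t : ℝ, ‖s • u + t • v‖ ≤ K * ‖G (s • u + t • v)‖) :
    ∃ C : ℝ, 0 < C ∧ ∀ (ε : ℝ) (h : E) (s t : ℝ), ‖D h - (s • u + t • v)‖ ≤ ε * ‖h‖ →
      ‖L h‖ ≤ ε * ‖h‖ → ∃ k, D k = 0 ∧ ‖h - k‖ ≤ C * ε * ‖h‖ := by
  obtain ⟨j, hj⟩ := D.exists_nonlinearRightInverse_of_surjective (LinearMap.range_eq_top.2 hD)
  refine ⟨j.nnnorm * (1 + K * (‖Λ‖ + ‖G‖)), by positivity, fun ε h s t h1 h2 => ?_⟩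
  -- It remains to bound `D h`. As `G (D h) = Λ (L h)` is small, so is `G p`, hence `p`, hence `D
  -- h`.
  refine ⟨h - j (D h), ?_, ?_⟩
  · rw [map_sub, j.right_inv, sub_self]
  rw [sub_sub_cancel]
  set p := s • u + t • v
  have h3 : ‖G p‖ ≤ (‖Λ‖ + ‖G‖) * (ε * ‖h‖) := by
    have : G p = Λ (L h) - G (D h - p) := by rw [map_sub, hG]; abel
    calc ‖G p‖ ≤ ‖Λ (L h)‖ + ‖G (D h - p)‖ := by rw [this]; exact norm_sub_le _ _
      _ ≤ ‖Λ‖ * ‖L h‖ + ‖G‖ * ‖D h - p‖ := add_le_add (Λ.le_opNorm _) (G.le_opNorm _)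
      _ ≤ ‖Λ‖ * (ε * ‖h‖) + ‖G‖ * (ε * ‖h‖) := by gcongr
      _ = _ := by ring
  have h4 : ‖D h‖ ≤ (1 + K * (‖Λ‖ + ‖G‖)) * (ε * ‖h‖) := by
    calc ‖D h‖ = ‖(D h - p) + p‖ := by rw [sub_add_cancel]
      _ ≤ ‖D h - p‖ + ‖p‖ := norm_add_le _ _
      _ ≤ ε * ‖h‖ + K * ((‖Λ‖ + ‖G‖) * (ε * ‖h‖)) :=
        add_le_add h1 ((huv s t).trans (mul_le_mul_of_nonneg_left h3 hK))
      _ = _ := by ring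
  calc ‖j (D h)‖ ≤ j.nnnorm * ‖D h‖ := j.bound _
    _ ≤ j.nnnorm * ((1 + K * (‖Λ‖ + ‖G‖)) * (ε * ‖h‖)) := by gcongr
    _ = _ := by ring

/-- Two vectors of the plane with nonzero determinant are quantitatively independent. -/
theorem abs_mul_det_le (a b : ℝ × ℝ) (s t : ℝ) :
    |s| * |a.1 * b.2 - a.2 * b.1| ≤ (2 * ‖b‖) * ‖s • a + t • b‖ ∧
    |t| * |a.1 * b.2 - a.2 * b.1| ≤ (2 * ‖a‖) * ‖s • a + t • b‖ := by
  have hx : |s * a.1 + t * b.1| ≤ ‖s • a + t • b‖ := norm_fst_le (s • a + t • b)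
  have hy : |s * a.2 + t * b.2| ≤ ‖s • a + t • b‖ := norm_snd_le (s • a + t • b)
  have ha1 : |a.1| ≤ ‖a‖ := norm_fst_le a
  have ha2 : |a.2| ≤ ‖a‖ := norm_snd_le a
  have hb1 : |b.1| ≤ ‖b‖ := norm_fst_le b
  have hb2 : |b.2| ≤ ‖b‖ := norm_snd_le b
  constructor
  · rw [← abs_mul, show s * (a.1 * b.2 - a.2 * b.1)
      = b.2 * (s * a.1 + t * b.1) - b.1 * (s * a.2 + t * b.2) by ring]
    refine (abs_sub _ _).trans ?_
    rw [abs_mul, abs_mul]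
    calc _ ≤ ‖b‖ * ‖s • a + t • b‖ + ‖b‖ * ‖s • a + t • b‖ := by gcongr
      _ = _ := by ring
  · rw [← abs_mul, show t * (a.1 * b.2 - a.2 * b.1)
      = a.1 * (s * a.2 + t * b.2) - a.2 * (s * a.1 + t * b.1) by ring]
    refine (abs_sub _ _).trans ?_
    rw [abs_mul, abs_mul]
    calc _ ≤ ‖a‖ * ‖s • a + t • b‖ + ‖a‖ * ‖s • a + t • b‖ := by gcongr
      _ = _ := by ring

/-- Linear algebra of a codimension two tangency under a projection with one-dimensional kernel:
there are directions `u`, `v` in a given dense set and a functional `τ` in a given separating set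
such that a vector almost killed by `L` with image almost in the span of `u` and `v` is controlled
by its value under `τ`.  Either `u` and `v` are independent, or `τ` vanishes. -/
theorem exists_directions [CompleteSpace E] [CompleteSpace Z]
    (D : E →L[ℝ] Z) (hD : Function.Surjective D) {e : E} (he : e ≠ 0)
    (hker : ∀ x, D x = 0 → ∃ r : ℝ, r • e = x) (L : E →L[ℝ] ℝ × ℝ) (hL : Function.Surjective L)
    {S : Set Z} (hS : Dense S) {T : Set (E →L[ℝ] ℝ)} (hT0 : 0 ∈ T)
    (hT : ∀ e : E, e ≠ 0 → ∃ τ ∈ T, τ e ≠ 0) :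
    ∃ u ∈ S, ∃ v ∈ S, ∃ τ ∈ T,
      ((∃ c > 0, ∀ s t : ℝ, c * |s| ≤ ‖s • u + t • v‖ ∧ c * |t| ≤ ‖s • u + t • v‖) ∨
        (τ = 0 ∧ u ≠ 0)) ∧
      ∃ ε > 0, ∃ C : ℝ, ∀ (h : E) (s t : ℝ), ‖D h - (s • u + t • v)‖ ≤ ε * ‖h‖ →
        ‖L h‖ ≤ ε * ‖h‖ → ‖h‖ ≤ C * |τ h| := by
  have he' : 0 < ‖e‖ := norm_pos_iff.2 he
  -- If `L e = 0`, all of `L` descends to `Z`. Independence of `G u` and `G v` is an open condition,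
  -- so `u` and `v` can be found in `S`.
  by_cases hLe : L e = 0
  · obtain ⟨G, hG⟩ := exists_clm_factor D hD L (fun x hx => by
      obtain ⟨r, rfl⟩ := hker x hx
      rw [map_smul, hLe, smul_zero])
    have hGs : Function.Surjective G := fun y => by
      obtain ⟨x, rfl⟩ := hL y
      exact ⟨D x, hG x⟩
    set det : Z × Z → ℝ := fun p => (G p.1).1 * (G p.2).2 - (G p.1).2 * (G p.2).1 with hdet
    have hdc : Continuous det := by fun_prop
    obtain ⟨a, ha⟩ := hGs (1, 0)
    obtain ⟨b, hb⟩ := hGs (0, 1)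
    obtain ⟨⟨u, v⟩, ⟨hu, hv⟩, huv⟩ := (hS.prod hS).exists_mem_open
      (isOpen_ne.preimage hdc : IsOpen (det ⁻¹' {x | x ≠ 0})) ⟨(a, b), by simp [hdet, ha, hb]⟩
    set δ : ℝ := |det (u, v)| with hδ
    have hδ0 : 0 < δ := abs_pos.2 huv
    have hGp : ∀ s t : ℝ, G (s • u + t • v) = s • G u + t • G v := fun s t => by simp
    have hs : ∀ s t : ℝ, |s| * δ ≤ 2 * ‖G v‖ * ‖G (s • u + t • v)‖ := fun s t => by
      rw [hGp]; exact (abs_mul_det_le (G u) (G v) s t).1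
    have ht : ∀ s t : ℝ, |t| * δ ≤ 2 * ‖G u‖ * ‖G (s • u + t • v)‖ := fun s t => by
      rw [hGp]; exact (abs_mul_det_le (G u) (G v) s t).2
    obtain ⟨C, hC, hnear⟩ := exists_near_ker D hD L (ContinuousLinearMap.id ℝ _) G hG
      (u := u) (v := v) (K := (2 * ‖G v‖ * ‖u‖ + 2 * ‖G u‖ * ‖v‖) / δ) (by positivity) (fun s t => by
        rw [div_mul_eq_mul_div, le_div_iff₀ hδ0]
        calc ‖s • u + t • v‖ * δ ≤ (|s| * ‖u‖ + |t| * ‖v‖) * δ := by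
              gcongr
              refine (norm_add_le _ _).trans_eq ?_
              rw [norm_smul, norm_smul, Real.norm_eq_abs, Real.norm_eq_abs]
          _ = |s| * δ * ‖u‖ + |t| * δ * ‖v‖ := by ring
          _ ≤ 2 * ‖G v‖ * ‖G (s • u + t • v)‖ * ‖u‖ + 2 * ‖G u‖ * ‖G (s • u + t • v)‖ * ‖v‖ := by
              exact add_le_add (mul_le_mul_of_nonneg_right (hs s t) (norm_nonneg _))
                (mul_le_mul_of_nonneg_right (ht s t) (norm_nonneg _))
          _ = _ := by ring)
    obtain ⟨τ, hτT, hτ⟩ := hT e he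
    have hτ' : 0 < |τ e| := abs_pos.2 hτ
    refine ⟨u, hu, v, hv, τ, hτT, Or.inl ?_, ?_⟩
    · set m : ℝ := 2 * (‖G u‖ + ‖G v‖ + 1) * (‖G‖ + 1) with hm
      have hm0 : 0 < m := by positivity
      have hle : ∀ (s t x r : ℝ), 0 ≤ r → r ≤ ‖G u‖ + ‖G v‖ →
          x * δ ≤ 2 * r * ‖G (s • u + t • v)‖ → δ / m * x ≤ ‖s • u + t • v‖ := by
        intro s t x r hr0 hr hx
        rw [div_mul_eq_mul_div, div_le_iff₀ hm0, mul_comm δ]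
        refine hx.trans ?_
        calc 2 * r * ‖G (s • u + t • v)‖ ≤ 2 * (‖G u‖ + ‖G v‖) * (‖G‖ * ‖s • u + t • v‖) := by
              gcongr
              exact G.le_opNorm _
          _ ≤ 2 * (‖G u‖ + ‖G v‖ + 1) * ((‖G‖ + 1) * ‖s • u + t • v‖) := by
              refine mul_le_mul (by linarith) ?_ (by positivity) (by positivity)
              exact mul_le_mul_of_nonneg_right (by linarith) (norm_nonneg _)
          _ = _ := by ring
      exact ⟨δ / m, by positivity, fun s t =>
        ⟨hle s t _ _ (norm_nonneg _) (by linarith [norm_nonneg (G u)]) (hs s t),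
         hle s t _ _ (norm_nonneg _) (by linarith [norm_nonneg (G v)]) (ht s t)⟩⟩
    · set C' : ℝ := ‖e‖ / |τ e| * ‖τ‖ * C + C with hC'
      have hC'0 : 0 < C' := by positivity
      -- With this `ε` the error terms amount to half of `‖h‖` and are absorbed on the left.
      refine ⟨1 / (2 * C'), by positivity, 2 * (‖e‖ / |τ e|), fun h s t h1 h2 => ?_⟩
      obtain ⟨k, hk, hhk⟩ := hnear _ h s t h1 h2
      obtain ⟨r, rfl⟩ := hker k hk
      have h3 : ‖h‖ ≤ |r| * ‖e‖ + ‖h - r • e‖ := by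
        have := norm_add_le (r • e) (h - r • e)
        rwa [add_sub_cancel, norm_smul, Real.norm_eq_abs] at this
      have h4 : |r| * |τ e| ≤ |τ h| + ‖τ‖ * ‖h - r • e‖ := by
        have h5 : r * τ e = τ h - τ (h - r • e) := by simp
        rw [← abs_mul, h5]
        exact (abs_sub _ _).trans (add_le_add_right (τ.le_opNorm _) _)
      have h6 : |r| * ‖e‖ ≤ ‖e‖ / |τ e| * (|τ h| + ‖τ‖ * ‖h - r • e‖) := by
        calc |r| * ‖e‖ = ‖e‖ / |τ e| * (|r| * |τ e|) := by field_simp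
          _ ≤ _ := by gcongr
      have h7 : C' * (1 / (2 * C')) = 1 / 2 := by field_simp
      have h8 : ‖h‖ ≤ ‖e‖ / |τ e| * |τ h| + C' * (1 / (2 * C')) * ‖h‖ := by
        calc ‖h‖ ≤ ‖e‖ / |τ e| * |τ h| + (‖e‖ / |τ e| * ‖τ‖ + 1) * ‖h - r • e‖ := by linarith
          _ ≤ ‖e‖ / |τ e| * |τ h| + (‖e‖ / |τ e| * ‖τ‖ + 1) * (C * (1 / (2 * C')) * ‖h‖) := by
            gcongr
          _ = _ := by rw [hC']; ring
      rw [h7] at h8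
      linarith
  -- Only the functional `Λ ∘ L`, with `Λ` annihilating `L e`, descends to `Z`, so one direction `u
  -- = v` is available. Smallness of `L h` now bounds the component along `e` too and forces `h =
  -- 0`; hence `τ = 0` and the constant `0`.
  · have hLe' : 0 < ‖L e‖ := norm_pos_iff.2 hLe
    set Λ : ℝ × ℝ →L[ℝ] ℝ := (L e).2 • ContinuousLinearMap.fst ℝ ℝ ℝ
      - (L e).1 • ContinuousLinearMap.snd ℝ ℝ ℝ with hΛ
    have hΛa : ∀ x, Λ x = (L e).2 * x.1 - (L e).1 * x.2 := fun x => by simp [hΛ]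
    obtain ⟨G, hG⟩ := exists_clm_factor D hD (Λ.comp L) (fun x hx => by
      obtain ⟨r, rfl⟩ := hker x hx
      rw [map_smul, ContinuousLinearMap.comp_apply, hΛa, smul_eq_mul]
      ring)
    obtain ⟨x, hx⟩ := hL ((L e).2, -(L e).1)
    have hGx : G (D x) ≠ 0 := by
      rw [hG, ContinuousLinearMap.comp_apply, hΛa, hx]
      intro h0
      apply hLe
      have h1 : (L e).1 = 0 := by nlinarith [sq_nonneg (L e).1, sq_nonneg (L e).2]
      have h2 : (L e).2 = 0 := by nlinarith [sq_nonneg (L e).1, sq_nonneg (L e).2]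
      exact Prod.ext h1 h2
    obtain ⟨u, hu, hGu⟩ := hS.exists_mem_open
      (isOpen_ne.preimage G.continuous : IsOpen (G ⁻¹' {x | x ≠ 0})) ⟨D x, hGx⟩
    have hGu' : 0 < |G u| := abs_pos.2 hGu
    obtain ⟨C, hC, hnear⟩ := exists_near_ker D hD L Λ G hG
      (u := u) (v := u) (K := ‖u‖ / |G u|) (by positivity) (fun s t => by
        rw [← add_smul, map_smul, norm_smul, norm_smul, Real.norm_eq_abs (G u)]
        apply le_of_eq
        field_simp)
    refine ⟨u, hu, u, hu, 0, hT0, Or.inr ⟨rfl, fun h0 => hGu (by rw [h0, map_zero])⟩, ?_⟩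
    set C' : ℝ := ‖e‖ / ‖L e‖ * (1 + ‖L‖ * C) + C with hC'
    have hC'0 : 0 < C' := by positivity
    refine ⟨1 / (2 * C'), by positivity, 0, fun h s t h1 h2 => ?_⟩
    obtain ⟨k, hk, hhk⟩ := hnear _ h s t h1 h2
    obtain ⟨r, rfl⟩ := hker k hk
    have h3 : ‖h‖ ≤ |r| * ‖e‖ + ‖h - r • e‖ := by
      have := norm_add_le (r • e) (h - r • e)
      rwa [add_sub_cancel, norm_smul, Real.norm_eq_abs] at this
    have h4 : |r| * ‖L e‖ ≤ ‖L h‖ + ‖L‖ * ‖h - r • e‖ := by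
      have h5 : r • L e = L h - L (h - r • e) := by simp
      rw [← Real.norm_eq_abs, ← norm_smul, h5]
      exact (norm_sub_le _ _).trans (add_le_add_right (L.le_opNorm _) _)
    have h6 : |r| * ‖e‖ ≤ ‖e‖ / ‖L e‖ * (‖L h‖ + ‖L‖ * ‖h - r • e‖) := by
      calc |r| * ‖e‖ = ‖e‖ / ‖L e‖ * (|r| * ‖L e‖) := by field_simp
        _ ≤ _ := by gcongr
    have h7 : C' * (1 / (2 * C')) = 1 / 2 := by field_simp
    have h8 : ‖h‖ ≤ C' * (1 / (2 * C')) * ‖h‖ := by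
      calc ‖h‖ ≤ ‖e‖ / ‖L e‖ * (‖L h‖ + ‖L‖ * ‖h - r • e‖) + ‖h - r • e‖ := by linarith
        _ ≤ ‖e‖ / ‖L e‖ * (1 / (2 * C') * ‖h‖ + ‖L‖ * (C * (1 / (2 * C')) * ‖h‖))
            + C * (1 / (2 * C')) * ‖h‖ := by gcongr
        _ = _ := by rw [hC']; ring
    rw [h7] at h8
    linarith [norm_nonneg h]

/-- Let every point `y` of `Y` lie in one of countably many sets `W i` such that the differences
`y' - y` for `y'` near `y` in `W i` are asymptotically in a subspace of codimension two.  Then the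
image of `Y` under a map whose derivatives on `Y` are onto with one-dimensional kernel is meagre. -/
theorem isMeagre_image_of_tangency [CompleteSpace E] [CompleteSpace Z]
    [TopologicalSpace.SeparableSpace E] [TopologicalSpace.SeparableSpace Z]
    {ι : Type*} [Countable ι] {W : ι → Set E} {Y : Set E}
    (hY : ∀ y ∈ Y, ∃ i, y ∈ W i ∧ ∃ L : E →L[ℝ] ℝ × ℝ, Function.Surjective L ∧
      (fun y' => L (y' - y)) =o[𝓝[W i] y] fun y' => y' - y)
    {f : E → Z} {f' : E → E →L[ℝ] Z} (hf : ∀ y ∈ Y, HasFDerivAt f (f' y) y)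
    (hsurj : ∀ y ∈ Y, Function.Surjective (f' y))
    (hker : ∀ y ∈ Y, ∃ e, e ≠ 0 ∧ ∀ x, f' y x = 0 → ∃ r : ℝ, r • e = x) :
    IsMeagre (f '' Y) := by
  obtain ⟨T, hTc, hT0, hT⟩ := exists_countable_separating_dual (E := E)
  obtain ⟨S, hSc, hS⟩ := TopologicalSpace.exists_countable_dense Z
  obtain ⟨A, hAc, hA⟩ := TopologicalSpace.exists_countable_dense E
  have := hTc.to_subtype
  have := hSc.to_subtype
  have := hAc.to_subtype
  -- The single integer `n` encodes radius, tolerance and constants. Closeness to `a` puts any two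
  -- points of a piece within the radius, so the bounds hold for all pairs.
  set P : ι → ℕ → A → S → S → T → Set E := fun i n a u v τ =>
    {y | y ∈ W i ∧ ‖y - a‖ < 1 / (2 * (n + 1)) ∧
      ((∃ c > 0, ∀ s t : ℝ, c * |s| ≤ ‖s • (u : Z) + t • (v : Z)‖ ∧
        c * |t| ≤ ‖s • (u : Z) + t • (v : Z)‖) ∨ ((τ : E →L[ℝ] ℝ) = 0 ∧ (u : Z) ≠ 0)) ∧
      ∀ y' ∈ W i, ‖y' - y‖ < 1 / (n + 1) → ‖f y' - f y‖ ≤ (n + 1) * ‖y' - y‖ ∧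
        ∀ s t : ℝ, ‖f y' - f y - (s • (u : Z) + t • (v : Z))‖ ≤ 1 / (n + 1) * ‖y' - y‖ →
          ‖y' - y‖ ≤ (n + 1) * |(τ : E →L[ℝ] ℝ) (y' - y)|} with hP
  have hnd : ∀ i n a u v τ, IsNowhereDense (f '' P i n a u v τ) := by
    intro i n a u v τ
    have hn : (0 : ℝ) < n + 1 := by positivity
    have hclose : ∀ x ∈ P i n a u v τ, ∀ y ∈ P i n a u v τ, ‖y - x‖ < 1 / (n + 1) := by
      intro x hx y hy
      have h1 := norm_sub_le (y - a) (x - a)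
      rw [sub_sub_sub_cancel_right] at h1
      have h2 : (1 : ℝ) / (2 * (n + 1)) + 1 / (2 * (n + 1)) = 1 / (n + 1) := by field_simp; norm_num
      linarith [hx.2.1, hy.2.1]
    rcases (P i n a u v τ).eq_empty_or_nonempty with h0 | ⟨y₀, hy₀⟩
    · rw [h0, image_empty]; exact isNowhereDense_empty
    rcases hy₀.2.2.1 with ⟨c, hc, huv⟩ | ⟨hτ, hu⟩
    · refine isNowhereDense_image_of_plane (τ := (τ : E →L[ℝ] ℝ)) hc huv hn
        (by positivity : (0 : ℝ) < 1 / (n + 1)) (K := ‖(τ : E →L[ℝ] ℝ)‖ * (‖(a : E)‖ + 1) + 1)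
        (by positivity) ?_
        (fun x hx y hy => (hx.2.2.2 y hy.1 (hclose x hx y hy)).1)
        (fun x hx y hy s t hst => by
          rw [← map_sub]
          exact (hx.2.2.2 y hy.1 (hclose x hx y hy)).2 s t hst)
      intro x hx
      have h1 : ‖x‖ ≤ ‖(a : E)‖ + 1 := by
        have h2 := norm_add_le (a : E) (x - a)
        rw [add_sub_cancel] at h2
        have h3 : (1 : ℝ) / (2 * (n + 1)) ≤ 1 := by
          rw [div_le_one (by positivity)]
          have : (0 : ℝ) ≤ n := n.cast_nonneg
          linarith
        linarith [hx.2.1]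
      calc |(τ : E →L[ℝ] ℝ) x| ≤ ‖(τ : E →L[ℝ] ℝ)‖ * ‖x‖ := (τ : E →L[ℝ] ℝ).le_opNorm x
        _ ≤ ‖(τ : E →L[ℝ] ℝ)‖ * (‖(a : E)‖ + 1) := by gcongr
        _ ≤ _ := by linarith
    · refine isNowhereDense_image_of_line hu hn (by positivity : (0 : ℝ) < 1 / (n + 1))
        (fun x hx y hy => (hx.2.2.2 y hy.1 (hclose x hx y hy)).1) (fun x hx y hy s hs => ?_)
      have h1 := (hx.2.2.2 y hy.1 (hclose x hx y hy)).2 s 0 (by rwa [zero_smul, add_zero])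
      rw [hτ, zero_apply, abs_zero, mul_zero, norm_le_zero_iff, sub_eq_zero] at h1
      exact h1
  have hcover : f '' Y ⊆ ⋃ (i) (n) (a) (u) (v) (τ), f '' P i n a u v τ := by
    rintro _ ⟨y, hy, rfl⟩
    obtain ⟨i, hyi, L, hL, hLo⟩ := hY y hy
    obtain ⟨e, he, hke⟩ := hker y hy
    obtain ⟨u, hu, v, hv, τ, hτ, hgood, ε, hε, C, hC⟩ :=
      exists_directions (f' y) (hsurj y hy) he hke L hL hS hT0 hT
    have hfo := (hasFDerivAt_iff_isLittleO.1 (hf y hy)).mono (nhdsWithin_le_nhds (s := W i))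
    have hev := (hfo.bound (half_pos hε)).and (hLo.bound hε)
    obtain ⟨ρ, hρ, hball⟩ := Metric.mem_nhdsWithin_iff.1 hev
    obtain ⟨n, hn⟩ := exists_nat_gt (1 / ρ + 2 / ε + |C| + (ε / 2 + ‖f' y‖))
    have hn1 : (0 : ℝ) < n + 1 := by positivity
    have p1 : 0 < 1 / ρ := by positivity
    have p2 : 0 < 2 / ε := by positivity
    have p3 := abs_nonneg C
    have p4 := norm_nonneg (f' y)
    have hnρ : 1 / ((n : ℝ) + 1) < ρ := by
      rw [div_lt_comm₀ hn1 hρ]; linarith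
    have hnε : 1 / ((n : ℝ) + 1) < ε / 2 := by
      rw [div_lt_comm₀ hn1 (by positivity), one_div_div]; linarith
    obtain ⟨a, ha, hya⟩ := hA.exists_dist_lt y (by positivity : (0 : ℝ) < 1 / (2 * (n + 1)))
    simp only [mem_iUnion]
    refine ⟨i, n, ⟨a, ha⟩, ⟨u, hu⟩, ⟨v, hv⟩, ⟨τ, hτ⟩, mem_image_of_mem f
      ⟨hyi, by rwa [dist_eq_norm] at hya, hgood, fun y' hy' hyy' => ?_⟩⟩
    obtain ⟨h1, h2⟩ := hball ⟨by rw [Metric.mem_ball, dist_eq_norm]; linarith, hy'⟩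
    constructor
    · calc ‖f y' - f y‖ = ‖(f y' - f y - f' y (y' - y)) + f' y (y' - y)‖ := by rw [sub_add_cancel]
        _ ≤ ε / 2 * ‖y' - y‖ + ‖f' y‖ * ‖y' - y‖ :=
          (norm_add_le _ _).trans (add_le_add h1 ((f' y).le_opNorm _))
        _ = (ε / 2 + ‖f' y‖) * ‖y' - y‖ := by ring
        _ ≤ (n + 1) * ‖y' - y‖ := mul_le_mul_of_nonneg_right (by linarith) (norm_nonneg _)
    · intro s t hst
      refine (hC (y' - y) s t ?_ h2).trans ?_
      · have h3 : f' y (y' - y) - (s • u + t • v)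
            = (f y' - f y - (s • u + t • v)) - (f y' - f y - f' y (y' - y)) := by abel
        have h4 : 1 / ((n : ℝ) + 1) * ‖y' - y‖ ≤ ε / 2 * ‖y' - y‖ := by gcongr
        rw [h3]
        have := norm_sub_le (f y' - f y - (s • u + t • v)) (f y' - f y - f' y (y' - y))
        have hst' : ‖f y' - f y - (s • u + t • v)‖ ≤ 1 / ((n : ℝ) + 1) * ‖y' - y‖ := hst
        linarith
      · change C * |τ (y' - y)| ≤ (n + 1) * |τ (y' - y)|
        gcongr
        linarith [le_abs_self C]
  refine IsMeagre.mono hcover ?_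
  exact isMeagre_iUnion fun i => isMeagre_iUnion fun n => isMeagre_iUnion fun a =>
    isMeagre_iUnion fun u => isMeagre_iUnion fun v => isMeagre_iUnion fun τ =>
      (hnd i n a u v τ).isMeagre

end Tangency

/-! ### Symmetric operators whose spectrum is isolated at zero. -/

section Hilbert

open scoped InnerProductSpace

variable {H : Type*} [NormedAddCommGroup H] [InnerProductSpace ℝ H]

/-- An invertible positive operator is bounded below by a positive multiple of the identity. -/
theorem exists_le_inner_of_isUnit {Q : H →L[ℝ] H} (hsymm : ∀ x y, ⟪Q x, y⟫_ℝ = ⟪x, Q y⟫_ℝ)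
    (hpos : ∀ x, 0 ≤ ⟪Q x, x⟫_ℝ) (hQ : IsUnit Q) :
    ∃ c > 0, ∀ x, c * ‖x‖ ^ 2 ≤ ⟪Q x, x⟫_ℝ := by
  obtain ⟨Qi, -, hQi⟩ := isUnit_iff_exists.1 hQ
  have hinv : ∀ x, Qi (Q x) = x := fun x => congrArg (fun T : H →L[ℝ] H => T x) hQi
  set t : ℝ := 1 / (‖Q‖ + 1) with ht
  have hn := norm_nonneg Q
  have ht0 : 0 < t := by positivity
  have htQ : t * ‖Q‖ ≤ 1 := by
    rw [ht, div_mul_eq_mul_div, one_mul, div_le_one (by positivity)]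
    linarith
  refine ⟨t / (‖Qi‖ + 1) ^ 2, by positivity, fun x => ?_⟩
  -- Positivity of `Q` at `x - t • Q x`, with `t * ‖Q‖ ≤ 1`.
  have h1 : t * ‖Q x‖ ^ 2 ≤ ⟪Q x, x⟫_ℝ := by
    have h2 := hpos (x - t • Q x)
    have h3 : ⟪Q (Q x), x⟫_ℝ = ‖Q x‖ ^ 2 := by rw [hsymm, real_inner_self_eq_norm_sq]
    have h4 : ⟪Q (Q x), Q x⟫_ℝ ≤ ‖Q‖ * ‖Q x‖ ^ 2 := by
      calc ⟪Q (Q x), Q x⟫_ℝ ≤ ‖Q (Q x)‖ * ‖Q x‖ := real_inner_le_norm _ _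
        _ ≤ ‖Q‖ * ‖Q x‖ * ‖Q x‖ := by gcongr; exact Q.le_opNorm _
        _ = _ := by ring
    simp only [map_sub, map_smul, inner_sub_left, inner_sub_right, inner_smul_left,
      inner_smul_right, h3, real_inner_self_eq_norm_sq, conj_trivial] at h2
    have h5 : t * (t * ⟪Q (Q x), Q x⟫_ℝ) ≤ t * ‖Q x‖ ^ 2 := by
      calc t * (t * ⟪Q (Q x), Q x⟫_ℝ) ≤ t * (t * (‖Q‖ * ‖Q x‖ ^ 2)) := by gcongr
        _ = t * (t * ‖Q‖ * ‖Q x‖ ^ 2) := by ring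
        _ ≤ t * (1 * ‖Q x‖ ^ 2) := by gcongr
        _ = _ := by ring
    linarith
  have h6 : ‖x‖ ≤ (‖Qi‖ + 1) * ‖Q x‖ := by
    calc ‖x‖ = ‖Qi (Q x)‖ := by rw [hinv]
      _ ≤ ‖Qi‖ * ‖Q x‖ := Qi.le_opNorm _
      _ ≤ _ := by gcongr; linarith
  refine le_trans ?_ h1
  rw [div_mul_eq_mul_div, div_le_iff₀ (by positivity)]
  calc t * ‖x‖ ^ 2 ≤ t * ((‖Qi‖ + 1) * ‖Q x‖) ^ 2 := by gcongr
    _ = _ := by ring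

/-- If the spectrum of a symmetric operator `S` near `0` is contained in `{0}`, then `S` is
bounded below on its range. -/
theorem norm_le_norm_apply_of_isolated {S : H →L[ℝ] H} (hsymm : ∀ x y, ⟪S x, y⟫_ℝ = ⟪x, S y⟫_ℝ)
    {d : ℝ} (hd : 0 < d) (hS : ∀ s : ℝ, s ≠ 0 → |s| < d → IsUnit (S - s • (1 : H →L[ℝ] H))) (x : H) :
    d * ‖S x‖ ≤ ‖S (S x)‖ := by
  -- The square of `S` has no spectrum in `(0, d ^ 2)`. Centring at the midpoint suggests `‖N x‖ ≥ d
  -- ^ 2 / 2 * ‖x‖`; expanding its square gives the claim.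
  set N : H →L[ℝ] H := S * S - (d ^ 2 / 2) • 1 with hN
  have hNx : ∀ x, N x = S (S x) - (d ^ 2 / 2) • x := fun x => rfl
  have hNsymm : ∀ x y, ⟪N x, y⟫_ℝ = ⟪x, N y⟫_ℝ := fun x y => by
    rw [hNx, hNx, inner_sub_left, inner_sub_right, hsymm, hsymm, inner_smul_left, inner_smul_right]
    rfl
  have hsq : ∀ σ : ℝ, 0 < σ → σ < d ^ 2 → IsUnit (S * S - σ • (1 : H →L[ℝ] H)) := by
    intro σ h0 h1
    have h2 : 0 < √σ := Real.sqrt_pos.2 h0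
    have h3 : √σ < d := (Real.sqrt_lt' hd).2 h1
    have h4 := (hS (√σ) h2.ne' (by rwa [abs_of_pos h2])).mul
      (hS (-√σ) (neg_ne_zero.2 h2.ne') (by rwa [abs_neg, abs_of_pos h2]))
    convert h4 using 1
    ext y
    have h5 : σ = √σ * √σ := (Real.mul_self_sqrt h0.le).symm
    simp only [sub_apply, mul_apply_eq_comp,
      smul_apply, one_apply_eq_self, map_sub, map_smul]
    conv_lhs => rw [h5, mul_smul]
    module
  have hlow : ∀ x, (d ^ 2 / 2) ^ 2 * ‖x‖ ^ 2 ≤ ‖N x‖ ^ 2 := by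
    by_contra! hcon
    obtain ⟨x₀, hx₀⟩ := hcon
    have hx₀' : 0 < ‖x₀‖ ^ 2 := by
      by_contra! h
      have : ‖x₀‖ ^ 2 = 0 := le_antisymm h (by positivity)
      rw [this, mul_zero] at hx₀
      exact absurd hx₀ (not_lt.2 (by positivity))
    -- If the best constant `c` were below `(d ^ 2 / 2) ^ 2`, then `N * N - c` would be nonnegative
    -- and a product of two units, hence bounded below by some `b > 0`, and `c + b` would be a
    -- better constant.
    set A : Set ℝ := {c | ∀ x, c * ‖x‖ ^ 2 ≤ ‖N x‖ ^ 2} with hA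
    have hA0 : (0 : ℝ) ∈ A := fun x => by rw [zero_mul]; positivity
    have hAb : BddAbove A := ⟨(d ^ 2 / 2) ^ 2, fun c hc => by
      have := (hc x₀).trans hx₀.le
      exact le_of_mul_le_mul_right this hx₀'⟩
    set c := sSup A with hc
    have hc0 : 0 ≤ c := le_csSup hAb hA0
    have hcA : c ∈ A := by
      intro x
      rcases eq_or_ne x 0 with rfl | hx
      · simp
      have hx' : 0 < ‖x‖ ^ 2 := by have := norm_pos_iff.2 hx; positivity
      rw [← le_div_iff₀ hx']
      exact csSup_le ⟨0, hA0⟩ fun b hb => by rw [le_div_iff₀ hx']; exact hb x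
    have hclt : √c < d ^ 2 / 2 := by
      rw [Real.sqrt_lt' (by positivity)]
      exact lt_of_mul_lt_mul_right ((hcA x₀).trans_lt hx₀) hx₀'.le
    have hcs := Real.sqrt_nonneg c
    have hu := (hsq (d ^ 2 / 2 + √c) (by positivity) (by linarith)).mul
      (hsq (d ^ 2 / 2 - √c) (by linarith) (by nlinarith))
    have heq : N * N - c • (1 : H →L[ℝ] H)
        = (S * S - (d ^ 2 / 2 + √c) • 1) * (S * S - (d ^ 2 / 2 - √c) • 1) := by
      ext y
      have h5 : c = √c * √c := (Real.mul_self_sqrt hc0).symm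
      simp only [hN, sub_apply, mul_apply_eq_comp,
        smul_apply, one_apply_eq_self, map_sub, map_smul]
      conv_lhs => rw [h5, mul_smul]
      module
    have hNN : ∀ x, ⟪(N * N - c • (1 : H →L[ℝ] H)) x, x⟫_ℝ = ‖N x‖ ^ 2 - c * ‖x‖ ^ 2 := fun x => by
      simp only [sub_apply, mul_apply_eq_comp,
        smul_apply, one_apply_eq_self, inner_sub_left,
        inner_smul_left, hNsymm (N x), real_inner_self_eq_norm_sq, conj_trivial]
    obtain ⟨b, hb, hbx⟩ := exists_le_inner_of_isUnit (Q := N * N - c • (1 : H →L[ℝ] H))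
      (fun x y => by
        simp only [sub_apply, mul_apply_eq_comp,
          smul_apply, one_apply_eq_self, inner_sub_left,
          inner_sub_right, inner_smul_left, inner_smul_right, hNsymm, conj_trivial])
      (fun x => by rw [hNN]; exact sub_nonneg.2 (hcA x)) (heq ▸ hu)
    have hmem : c + b ∈ A := fun x => by
      have := hbx x
      rw [hNN] at this
      linarith
    have := le_csSup hAb hmem
    linarith
  have h1 := hlow x
  have h2 : ‖N x‖ ^ 2 = ‖S (S x)‖ ^ 2 - d ^ 2 * ‖S x‖ ^ 2 + (d ^ 2 / 2) ^ 2 * ‖x‖ ^ 2 := by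
    rw [hNx, norm_sub_sq_real, inner_smul_right, hsymm (S x), real_inner_self_eq_norm_sq, norm_smul,
      Real.norm_of_nonneg (by positivity)]
    ring
  have h3 : (d * ‖S x‖) ^ 2 ≤ ‖S (S x)‖ ^ 2 := by rw [mul_pow]; linarith
  exact le_of_sq_le_sq h3 (norm_nonneg _)

/-- If the spectrum of a symmetric operator `S` near `0` is contained in `{0}`, then the sum of `S`
and of the projection onto its kernel is invertible. -/
theorem exists_proj_isUnit_add_of_isolated [CompleteSpace H] {S : H →L[ℝ] H}
    (hsymm : ∀ x y, ⟪S x, y⟫_ℝ = ⟪x, S y⟫_ℝ) {d : ℝ} (hd : 0 < d)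
    (hS : ∀ s : ℝ, s ≠ 0 → |s| < d → IsUnit (S - s • (1 : H →L[ℝ] H))) :
    ∃ P : H →L[ℝ] H, (∀ x, S (P x) = 0) ∧ (∀ x, S x = 0 → P x = x) ∧ IsUnit (S + P) := by
  set V : Submodule ℝ H := LinearMap.ker (S : H →ₗ[ℝ] H) with hV
  have hVmem : ∀ x, x ∈ V ↔ S x = 0 := fun x => LinearMap.mem_ker
  have : CompleteSpace V := (ContinuousLinearMap.isClosed_ker S).completeSpace_coe
  set R : Submodule ℝ H := LinearMap.range (S : H →ₗ[ℝ] H) with hR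
  have hRo : Rᗮ = V := by
    ext x
    rw [Submodule.mem_orthogonal, hVmem]
    constructor
    · intro h
      have h1 := h (S (S x)) ⟨S x, rfl⟩
      rw [hsymm] at h1
      exact inner_self_eq_zero.1 h1
    · rintro h _ ⟨y, rfl⟩
      change ⟪S y, x⟫_ℝ = 0
      rw [hsymm, h, inner_zero_right]
  -- The lower bound on the range extends to its closure, which is `Vᗮ`.
  have hlow : ∀ w ∈ Vᗮ, d * ‖w‖ ≤ ‖S w‖ := by
    intro w hw
    rw [← hRo, Submodule.orthogonal_orthogonal_eq_closure] at hw
    have hcl : IsClosed {w : H | d * ‖w‖ ≤ ‖S w‖} := isClosed_le (by fun_prop) (by fun_prop)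
    refine closure_minimal ?_ hcl hw
    rintro _ ⟨y, rfl⟩
    exact norm_le_norm_apply_of_isolated hsymm hd hS y
  set P : H →L[ℝ] H := V.starProjection with hP
  have hPV : ∀ x, P x ∈ V := fun x => V.starProjection_apply_mem x
  have hPo : ∀ x, x - P x ∈ Vᗮ := fun x => V.sub_starProjection_mem_orthogonal x
  have hSP : ∀ x, S (P x) = 0 := fun x => (hVmem _).1 (hPV x)
  refine ⟨P, hSP, fun x hx => Submodule.starProjection_eq_self_iff.2 ((hVmem x).2 hx), ?_⟩
  have hQsymm : ∀ x y, ⟪(S + P) x, y⟫_ℝ = ⟪x, (S + P) y⟫_ℝ := fun x y => by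
    rw [add_apply, add_apply, inner_add_left,
      inner_add_right, hsymm, V.inner_starProjection_left_eq_right]
  have hnorm : ∀ x, ‖x‖ ^ 2 * min (d ^ 2) 1 ≤ ‖(S + P) x‖ ^ 2 := by
    intro x
    have h1 : ⟪S x, P x⟫_ℝ = 0 := by rw [hsymm, hSP, inner_zero_right]
    have h2 : ‖(S + P) x‖ ^ 2 = ‖S x‖ ^ 2 + ‖P x‖ ^ 2 := by
      rw [add_apply, norm_add_sq_real, h1]; ring
    have h3 : ‖x‖ ^ 2 = ‖x - P x‖ ^ 2 + ‖P x‖ ^ 2 := by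
      have h4 : ⟪x - P x, P x⟫_ℝ = 0 := V.inner_left_of_mem_orthogonal (hPV x) (hPo x)
      have h5 := norm_add_sq_real (x - P x) (P x)
      rw [h4, sub_add_cancel] at h5
      linarith
    have h6 : d ^ 2 * ‖x - P x‖ ^ 2 ≤ ‖S x‖ ^ 2 := by
      have h7 := hlow _ (hPo x)
      rw [map_sub, hSP, sub_zero] at h7
      rw [← mul_pow]
      gcongr
    rw [h2, h3, add_mul]
    have h8 : ‖x - P x‖ ^ 2 * min (d ^ 2) 1 ≤ ‖x - P x‖ ^ 2 * d ^ 2 := by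
      gcongr; exact min_le_left _ _
    have h9 : ‖P x‖ ^ 2 * min (d ^ 2) 1 ≤ ‖P x‖ ^ 2 * 1 := by
      gcongr; exact min_le_right _ _
    linarith
  -- By symmetry of `S + P`, the lower bound makes its square coercive.
  have hunit : IsUnit ((S + P) * (S + P)) := by
    have hm : 0 < min (d ^ 2) 1 := by positivity
    refine ContinuousLinearMap.isUnit_of_forall_le_norm_inner_map _
      (c := ⟨min (d ^ 2) 1, hm.le⟩) hm fun x => ?_
    rw [mul_apply_eq_comp, hQsymm, real_inner_self_eq_norm_sq,
      Real.norm_of_nonneg (by positivity)]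
    exact hnorm x
  exact (Commute.refl (S + P)).isUnit_mul_iff.1 hunit |>.1

end Hilbert

/-! ### Transfer to an equivalent inner product. -/

section EquivInner

variable {H : Type*} [NormedAddCommGroup H] [NormedSpace ℝ H]

/-- The version of `exists_proj_isUnit_add_of_isolated` for an equivalent inner product. -/
theorem IsEquivInner.exists_proj_isUnit_add_of_isolated [CompleteSpace H]
    {g : H →L[ℝ] H →L[ℝ] ℝ} (hg : IsEquivInner g) {S : H →L[ℝ] H}
    (hsymm : ∀ x y, g (S x) y = g x (S y)) {d : ℝ} (hd : 0 < d)
    (hS : ∀ s : ℝ, s ≠ 0 → |s| < d → IsUnit (S - s • (1 : H →L[ℝ] H))) :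
    ∃ P : H →L[ℝ] H, (∀ x, S (P x) = 0) ∧ (∀ x, S x = 0 → P x = x) ∧ IsUnit (S + P) := by
  obtain ⟨c, hc, hcoer⟩ := hg.coercive
  let core : InnerProductSpace.Core ℝ H :=
    { inner := fun v w => g v w
      conj_inner_symm := fun v w => hg.symm w v
      re_inner_nonneg := fun v => (by positivity : 0 ≤ c * ‖v‖ ^ 2).trans (hcoer v)
      add_left := fun v w x => by simp
      smul_left := fun v w r => by simp
      definite := fun v h => by
        have h1 := hcoer v
        have h2 : g v v = 0 := h
        rw [h2] at h1
        have h3 : ‖v‖ ^ 2 ≤ 0 := by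
          by_contra! h4
          nlinarith
        exact norm_eq_zero.1 (pow_eq_zero_iff two_ne_zero |>.1 (le_antisymm h3 (by positivity))) }
  have hcont : ContinuousAt (fun v : H => g v v) 0 := by fun_prop
  have hbdd : Bornology.IsVonNBounded ℝ {v : H | g v v < 1} := by
    rw [NormedSpace.isVonNBounded_iff, isBounded_iff_forall_norm_le]
    refine ⟨1 / c + 1, fun v hv => ?_⟩
    have h1 := (hcoer v).trans (le_of_lt hv)
    rw [← le_div_iff₀' hc] at h1
    nlinarith [norm_nonneg v, sq_nonneg (‖v‖ - 1)]
  -- A uniform group structure is determined by its topology, so completeness passes to the norm of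
  -- `g`.
  have huni : ∀ U V : UniformSpace H, @IsUniformAddGroup H U _ → @IsUniformAddGroup H V _ →
      U.toTopologicalSpace = V.toTopologicalSpace → @CompleteSpace H V → @CompleteSpace H U := by
    intro U V hU hV h hc
    have : U = V := IsUniformAddGroup.ext hU hV (by rw [h])
    rw [this]
    exact hc
  have hc₀ : CompleteSpace H := inferInstance
  have hu₀ : IsUniformAddGroup H := inferInstance
  let ips := InnerProductSpace.ofCoreOfTopology core hcont hbdd
  let nacg : NormedAddCommGroup H := core.toNormedAddCommGroupOfTopology hcont hbdd
  have hcomplete : @CompleteSpace H nacg.toUniformSpace :=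
    huni _ _ (@SeminormedAddCommGroup.to_isUniformAddGroup H nacg.toSeminormedAddCommGroup)
      hu₀ rfl hc₀
  exact @MeagreCodim.exists_proj_isUnit_add_of_isolated H nacg ips hcomplete S hsymm d hd hS

end EquivInner

/-! ### Perturbation of a multiple eigenvalue of a bounded operator. -/

section Perturbation

variable {H : Type*} [NormedAddCommGroup H] [NormedSpace ℝ H]

/-- Eigenvectors survive a perturbation of the operator that preserves the multiplicity of the
eigenvalue, with an error controlled by the size of the perturbation. -/
theorem exists_eigenvector_near [CompleteSpace H] {T P : H →L[ℝ] H} {κ : ℝ}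
    (hP : ∀ x, T (P x) = κ • P x) (hP' : ∀ x, T x = κ • x → P x = x)
    (hunit : IsUnit (T - κ • (1 : H →L[ℝ] H) + P))
    [FiniteDimensional ℝ (LinearMap.ker ((T - κ • (1 : H →L[ℝ] H) : H →L[ℝ] H) : H →ₗ[ℝ] H))] :
    ∃ r > 0, ∃ K > 0, ∀ (T' : H →L[ℝ] H) (κ' : ℝ), ‖T' - T‖ < r → |κ' - κ| < r →
      FiniteDimensional ℝ (LinearMap.ker ((T' - κ' • (1 : H →L[ℝ] H) : H →L[ℝ] H) : H →ₗ[ℝ] H)) →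
      Module.finrank ℝ (LinearMap.ker ((T' - κ' • (1 : H →L[ℝ] H) : H →L[ℝ] H) : H →ₗ[ℝ] H)) =
        Module.finrank ℝ (LinearMap.ker ((T - κ • (1 : H →L[ℝ] H) : H →L[ℝ] H) : H →ₗ[ℝ] H)) →
      ∀ v, T v = κ • v → ∃ w, T' (v + w) = κ' • (v + w) ∧ ‖w‖ ≤ K * ‖T' - T‖ * ‖v‖ := by
  set Q : H →L[ℝ] H := T - κ • (1 : H →L[ℝ] H) + P with hQ
  have hcont : ContinuousAt (Ring.inverse : (H →L[ℝ] H) → (H →L[ℝ] H)) Q := by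
    obtain ⟨u, hu⟩ := hunit
    rw [← hu]
    exact NormedRing.inverse_continuousAt u
  have hev : ∀ᶠ B in 𝓝 Q, IsUnit B ∧ ‖Ring.inverse B‖ < ‖Ring.inverse Q‖ + 1 :=
    Eventually.and (Units.isOpen.mem_nhds hunit) (hcont.norm.eventually_lt_const (lt_add_one _))
  obtain ⟨δ, hδ, hball⟩ := Metric.eventually_nhds_iff.1 hev
  refine ⟨δ / 2, by positivity, ‖Ring.inverse Q‖ + 1, by positivity, ?_⟩
  intro T' κ' hT hκ hfin hrank v hv
  set V := LinearMap.ker ((T - κ • (1 : H →L[ℝ] H) : H →L[ℝ] H) : H →ₗ[ℝ] H) with hV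
  set V' := LinearMap.ker ((T' - κ' • (1 : H →L[ℝ] H) : H →L[ℝ] H) : H →ₗ[ℝ] H) with hV'
  have hVm : ∀ x, x ∈ V ↔ T x = κ • x := fun x => by
    rw [hV, LinearMap.mem_ker]; exact sub_eq_zero
  have hVm' : ∀ x, x ∈ V' ↔ T' x = κ' • x := fun x => by
    rw [hV', LinearMap.mem_ker]; exact sub_eq_zero
  set Q' : H →L[ℝ] H := T' - κ' • (1 : H →L[ℝ] H) + P with hQ'
  have hQx : ∀ x, Q' x = T' x - κ' • x + P x := fun x => rfl
  have hone : ‖(1 : H →L[ℝ] H)‖ ≤ 1 := ContinuousLinearMap.norm_id_le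
  have hdist : dist Q' Q < δ := by
    have : Q' - Q = (T' - T) - (κ' - κ) • (1 : H →L[ℝ] H) := by rw [hQ, hQ', sub_smul]; abel
    rw [dist_eq_norm, this]
    calc _ ≤ ‖T' - T‖ + ‖(κ' - κ) • (1 : H →L[ℝ] H)‖ := norm_sub_le _ _
      _ ≤ ‖T' - T‖ + |κ' - κ| * 1 := by
        rw [norm_smul, Real.norm_eq_abs]; gcongr
      _ < δ := by linarith
  obtain ⟨hu, hinv⟩ := hball hdist
  set I := Ring.inverse Q' with hI
  have hIQ : ∀ x, I (Q' x) = x := fun x =>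
    congrArg (fun B : H →L[ℝ] H => B x) (Ring.inverse_mul_cancel Q' hu)
  -- On `V'` the invertible operator `Q'` equals `P`, so `P` is injective from `V'` to `V`, and onto
  -- by equality of dimensions.
  have hmaps : ∀ x ∈ V', P x ∈ V := fun x _ => (hVm _).2 (hP x)
  set p : V' →ₗ[ℝ] V := (P : H →ₗ[ℝ] H).restrict hmaps with hp
  have hinj : Function.Injective p := by
    rw [injective_iff_map_eq_zero]
    intro x hx
    have h1 : P (x : H) = 0 := congrArg Subtype.val hx
    have h2 : Q' (x : H) = 0 := by rw [hQx, (hVm' _).1 x.2, sub_self, h1, add_zero]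
    have h3 := hIQ (x : H)
    rw [h2, map_zero] at h3
    exact Subtype.ext h3.symm
  have hsurj := (LinearMap.injective_iff_surjective_of_finrank_eq_finrank hrank).1 hinj
  obtain ⟨x, hx⟩ := hsurj ⟨v, (hVm v).2 hv⟩
  have hPx : P (x : H) = v := congrArg Subtype.val hx
  have hQ'x : Q' (x : H) = v := by rw [hQx, (hVm' _).1 x.2, sub_self, hPx, zero_add]
  -- Applying `I` to `Q' v = (1 + κ - κ') • v + (T' - T) v`, where `v = Q' x`, shows that `v - I
  -- ((T' - T) v)` is a multiple of the eigenvector `x`.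
  refine ⟨-(I ((T' - T) v)), ?_, ?_⟩
  · have h1 : Q' v = (1 + κ - κ') • v + (T' - T) v := by
      rw [hQx, hP' v hv, sub_apply, hv]; module
    have h2 : v + -(I ((T' - T) v)) = (1 + κ - κ') • (x : H) := by
      have h3 : (T' - T) v = Q' v - (1 + κ - κ') • Q' (x : H) := by rw [hQ'x, h1]; abel
      rw [h3, map_sub, map_smul, hIQ, hIQ]; abel
    rw [h2, map_smul, (hVm' _).1 x.2, smul_comm]
  · rw [norm_neg]
    calc ‖I ((T' - T) v)‖ ≤ ‖I‖ * ‖(T' - T) v‖ := I.le_opNorm _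
      _ ≤ (‖Ring.inverse Q‖ + 1) * (‖T' - T‖ * ‖v‖) := by
        gcongr
        exact (T' - T).le_opNorm _
      _ = _ := by ring

/-- Perturbation of a multiple eigenvalue `κ` of an operator symmetric for `g`: if the multiplicity is
preserved, then the compression of the perturbation to two orthonormal eigenvectors is scalar up to
second order. -/
theorem exists_bound_compression [CompleteSpace H] {g : H →L[ℝ] H →L[ℝ] ℝ}
    {T P : H →L[ℝ] H} {κ : ℝ} (hsymm : ∀ x y, g (T x) y = g x (T y))
    (hP : ∀ x, T (P x) = κ • P x) (hP' : ∀ x, T x = κ • x → P x = x)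
    (hunit : IsUnit (T - κ • (1 : H →L[ℝ] H) + P))
    [FiniteDimensional ℝ (LinearMap.ker ((T - κ • (1 : H →L[ℝ] H) : H →L[ℝ] H) : H →ₗ[ℝ] H))]
    {v₁ v₂ : H} (hv₁ : T v₁ = κ • v₁) (hv₂ : T v₂ = κ • v₂)
    (h₁₁ : g v₁ v₁ = 1) (h₂₂ : g v₂ v₂ = 1) (h₁₂ : g v₁ v₂ = 0) :
    ∃ r > 0, ∃ C > 0, ∀ (T' : H →L[ℝ] H) (κ' : ℝ), ‖T' - T‖ < r → |κ' - κ| < r →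
      FiniteDimensional ℝ (LinearMap.ker ((T' - κ' • (1 : H →L[ℝ] H) : H →L[ℝ] H) : H →ₗ[ℝ] H)) →
      Module.finrank ℝ (LinearMap.ker ((T' - κ' • (1 : H →L[ℝ] H) : H →L[ℝ] H) : H →ₗ[ℝ] H)) =
        Module.finrank ℝ (LinearMap.ker ((T - κ • (1 : H →L[ℝ] H) : H →L[ℝ] H) : H →ₗ[ℝ] H)) →
      |g ((T' - T) v₁) v₁ - g ((T' - T) v₂) v₂| ≤ C * ‖T' - T‖ ^ 2 ∧
        |g ((T' - T) v₁) v₂| ≤ C * ‖T' - T‖ ^ 2 := by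
  obtain ⟨r, hr, K, hK, hnear⟩ := exists_eigenvector_near hP hP' hunit
  set M : ℝ := ‖v₁‖ + ‖v₂‖ + 1 with hM
  have hM0 : 0 < M := by positivity
  have hM₁ : ‖v₁‖ ≤ M := by linarith [norm_nonneg v₂]
  have hM₂ : ‖v₂‖ ≤ M := by linarith [norm_nonneg v₁]
  set a : ℝ := ‖g‖ * K * M ^ 2 with ha
  have ha0 : 0 ≤ a := by positivity
  set b : ℝ := ‖g‖ * M ^ 2 with hb
  have hb0 : 0 ≤ b := by positivity
  -- The second radius gives `|g w₁ v₁| ≤ 1 / 2`, keeping `1 + g w₁ v₁` away from zero.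
  refine ⟨min r (1 / (2 * (a + 1))), by positivity, 2 * ((2 * b + 2) * a) + 1, by positivity, ?_⟩
  intro T' κ' hT hκ hfin hrank
  set Δ := T' - T with hΔ
  have hTr : ‖Δ‖ < r := hT.trans_le (min_le_left _ _)
  have hTa : a * ‖Δ‖ ≤ 1 / 2 := by
    have h1 : ‖Δ‖ ≤ 1 / (2 * (a + 1)) := hT.le.trans (min_le_right _ _)
    calc a * ‖Δ‖ ≤ (a + 1) * (1 / (2 * (a + 1))) := by gcongr; linarith
      _ = 1 / 2 := by field_simp
  have hn := norm_nonneg Δ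
  have hgle : ∀ x y : H, ‖y‖ ≤ M → |g x y| ≤ ‖g‖ * ‖x‖ * M := fun x y hy =>
    (g.le_opNorm₂ x y).trans (by gcongr)
  -- Pair `T' (v + w) = κ' • (v + w)` with `y` and move `T` from `w` to `y`; only the symmetry of
  -- `T`, not of `T'`, enters.
  have key : ∀ v, ‖v‖ ≤ M → T v = κ • v → ∃ w : H, ∀ y, ‖y‖ ≤ M → T y = κ • y →
      g (Δ v) y = (κ' - κ) * (g v y + g w y) - g (Δ w) y ∧ |g w y| ≤ a * ‖Δ‖ ∧
        |g (Δ w) y| ≤ a * ‖Δ‖ ^ 2 := by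
    intro v hvM hv
    obtain ⟨w, hw, hwn⟩ := hnear T' κ' hTr (hκ.trans_le (min_le_left _ _)) hfin hrank v hv
    have hwn' : ‖w‖ ≤ K * ‖Δ‖ * M := hwn.trans (by gcongr)
    refine ⟨w, fun y hyM hy => ⟨?_, ?_, ?_⟩⟩
    · have h1 : T' = T + Δ := by rw [hΔ]; abel
      have h2 := congrArg (fun x => g x y) hw
      simp only [h1, add_apply, map_add, map_smul, smul_add, smul_apply, hv, hsymm w y, hy,
        smul_eq_mul] at h2
      linarith
    · calc |g w y| ≤ ‖g‖ * ‖w‖ * M := hgle w y hyM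
        _ ≤ ‖g‖ * (K * ‖Δ‖ * M) * M := by gcongr
        _ = a * ‖Δ‖ := by rw [ha]; ring
    · calc |g (Δ w) y| ≤ ‖g‖ * ‖Δ w‖ * M := hgle _ y hyM
        _ ≤ ‖g‖ * (‖Δ‖ * (K * ‖Δ‖ * M)) * M := by
          gcongr
          exact (Δ.le_opNorm w).trans (by gcongr)
        _ = a * ‖Δ‖ ^ 2 := by rw [ha]; ring
  obtain ⟨w₁, hw₁⟩ := key v₁ hM₁ hv₁
  obtain ⟨w₂, hw₂⟩ := key v₂ hM₂ hv₂
  obtain ⟨e₁₁, f₁₁, k₁₁⟩ := hw₁ v₁ hM₁ hv₁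
  obtain ⟨e₁₂, f₁₂, k₁₂⟩ := hw₁ v₂ hM₂ hv₂
  obtain ⟨e₂₂, f₂₂, k₂₂⟩ := hw₂ v₂ hM₂ hv₂
  rw [h₁₁] at e₁₁
  rw [h₁₂, zero_add] at e₁₂
  rw [h₂₂] at e₂₂
  have hsq : a * ‖Δ‖ ^ 2 ≤ 1 / 2 * ‖Δ‖ := by
    calc a * ‖Δ‖ ^ 2 = a * ‖Δ‖ * ‖Δ‖ := by ring
      _ ≤ _ := by gcongr
  -- The `v₁, v₁` entry shows that the eigenvalue shift is of first order, so its products with `g w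
  -- y` are of second order.
  have hκΔ : |κ' - κ| ≤ (2 * b + 1) * ‖Δ‖ := by
    have h1 : |g (Δ v₁) v₁| ≤ b * ‖Δ‖ := by
      calc |g (Δ v₁) v₁| ≤ ‖g‖ * ‖Δ v₁‖ * M := hgle _ _ hM₁
        _ ≤ ‖g‖ * (‖Δ‖ * M) * M := by
          gcongr
          exact (Δ.le_opNorm _).trans (by gcongr)
        _ = _ := by rw [hb]; ring
    have h2 : |κ' - κ| * |1 + g w₁ v₁| ≤ b * ‖Δ‖ + 1 / 2 * ‖Δ‖ := by
      rw [← abs_mul]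
      have h3 : (κ' - κ) * (1 + g w₁ v₁) = g (Δ v₁) v₁ + g (Δ w₁) v₁ := by linarith
      rw [h3]
      exact (abs_add_le _ _).trans (add_le_add h1 (k₁₁.trans hsq))
    have h4 : 1 / 2 ≤ |1 + g w₁ v₁| := by
      have := abs_le.1 (f₁₁.trans hTa)
      exact le_trans (by linarith) (le_abs_self _)
    have h5 : |κ' - κ| * (1 / 2) ≤ |κ' - κ| * |1 + g w₁ v₁| := by gcongr
    linarith
  have hprod : ∀ x : ℝ, |x| ≤ a * ‖Δ‖ → |(κ' - κ) * x| ≤ (2 * b + 1) * a * ‖Δ‖ ^ 2 := by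
    intro x hx
    rw [abs_mul]
    calc |κ' - κ| * |x| ≤ ((2 * b + 1) * ‖Δ‖) * (a * ‖Δ‖) := by gcongr
      _ = _ := by ring
  have p₁₁ := hprod _ f₁₁
  have p₁₂ := hprod _ f₁₂
  have p₂₂ := hprod _ f₂₂
  have hq : 0 ≤ ‖Δ‖ ^ 2 := by positivity
  have haq : 0 ≤ a * ‖Δ‖ ^ 2 := by positivity
  have hbq : 0 ≤ (2 * b + 1) * a * ‖Δ‖ ^ 2 := by positivity
  have hsum : (2 * ((2 * b + 2) * a) + 1) * ‖Δ‖ ^ 2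
      = 2 * ((2 * b + 1) * a * ‖Δ‖ ^ 2) + 2 * (a * ‖Δ‖ ^ 2) + ‖Δ‖ ^ 2 := by ring
  rw [abs_le] at p₁₁ p₁₂ p₂₂ k₁₁ k₁₂ k₂₂
  rw [mul_add, mul_one] at e₁₁ e₂₂
  -- The first-order term `κ' - κ` cancels between the diagonal entries and is absent off the
  -- diagonal.
  rw [hsum, e₁₁, e₂₂, e₁₂, abs_le, abs_le]
  exact ⟨⟨by linarith, by linarith⟩, by linarith, by linarith⟩

end Perturbation

/-! ### Eigenspaces and spectrum of an operator read off its resolvent. -/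

section Resolvent

variable {H : Type*} [NormedAddCommGroup H] [NormedSpace ℝ H] {A : H →ₗ.[ℝ] H} {μ : ℝ}
  {R : H →L[ℝ] H}

theorem isResolventOf_resolvent (hμ : μ ∈ resolventSet A) :
    IsResolventOf A μ (resolvent A μ) := by
  rw [resolvent, dif_pos hμ]
  exact hμ.choose_spec

theorem mem_eigenspace_iff {l : ℝ} {x : H} :
    x ∈ eigenspace A l ↔ ∃ hx : x ∈ A.domain, A ⟨x, hx⟩ = l • x := by
  change (x, l • x) ∈ A.graph ↔ _
  rw [LinearPMap.mem_graph_iff]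
  constructor
  · rintro ⟨y, rfl, hy⟩
    exact ⟨y.2, hy⟩
  · rintro ⟨hx, h⟩
    exact ⟨⟨x, hx⟩, rfl, h⟩

theorem IsResolventOf.ne_of_eigenspace_ne_bot (hR : IsResolventOf A μ R) {l : ℝ}
    (hl : eigenspace A l ≠ ⊥) : μ - l ≠ 0 := by
  intro h
  apply hl
  rw [Submodule.eq_bot_iff]
  intro x hx
  obtain ⟨hxd, hAx⟩ := mem_eigenspace_iff.1 hx
  have h1 := hR.left_inv ⟨x, hxd⟩
  rw [hAx, ← sub_smul, h, zero_smul, map_zero] at h1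
  exact h1.symm

/-- Reduces eigenvalue questions for the unbounded `A` to the bounded operator `R`, without changing
eigenvectors. -/
theorem IsResolventOf.mem_eigenspace_iff (hR : IsResolventOf A μ R) {l : ℝ} (hl : μ - l ≠ 0)
    {x : H} : x ∈ eigenspace A l ↔ R x = (μ - l)⁻¹ • x := by
  rw [MeagreCodim.mem_eigenspace_iff]
  constructor
  · rintro ⟨hx, hAx⟩
    have h1 := hR.left_inv ⟨x, hx⟩
    rw [hAx, ← sub_smul, map_smul] at h1
    rw [eq_inv_smul_iff₀ hl]
    exact h1
  · intro h
    have hx : x = (μ - l) • R x := by rw [h, smul_inv_smul₀ hl]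
    have hmem : x ∈ A.domain := by
      rw [hx]; exact A.domain.smul_mem _ (hR.mem_domain x)
    refine ⟨hmem, ?_⟩
    have h2 : (⟨x, hmem⟩ : A.domain) = (μ - l) • ⟨R x, hR.mem_domain x⟩ := Subtype.ext hx
    have h3 := hR.right_inv x
    have h4 : A ⟨R x, hR.mem_domain x⟩ = μ • R x - x := 
      eq_sub_iff_add_eq'.2 (sub_eq_iff_eq_add.1 h3).symm
    rw [h2, A.map_smul, h4, smul_sub, smul_comm, ← hx, ← sub_smul]
    congr 1
    ring

theorem IsResolventOf.eigenspace_eq_ker (hR : IsResolventOf A μ R) {l : ℝ} (hl : μ - l ≠ 0) :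
    eigenspace A l =
      LinearMap.ker ((R - (μ - l)⁻¹ • (1 : H →L[ℝ] H) : H →L[ℝ] H) : H →ₗ[ℝ] H) := by
  ext x
  rw [hR.mem_eigenspace_iff hl, LinearMap.mem_ker]
  exact sub_eq_zero.symm

theorem IsResolventOf.symmetric (hR : IsResolventOf A μ R) {g : H →L[ℝ] H →L[ℝ] ℝ}
    (hA : IsSelfAdjointFor g A) (x y : H) : g (R x) y = g x (R y) := by
  have h1 := (hA.adjoint_graph (R y) (A ⟨R y, hR.mem_domain y⟩)).2
    (A.mem_graph ⟨R y, hR.mem_domain y⟩) ⟨R x, hR.mem_domain x⟩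
  calc g (R x) y = g (R x) (μ • R y - A ⟨R y, hR.mem_domain y⟩) := by rw [hR.right_inv]
    _ = g (μ • R x - A ⟨R x, hR.mem_domain x⟩) (R y) := by
      simp only [map_sub, map_smul, sub_apply, smul_apply, h1]
    _ = g x (R y) := by rw [hR.right_inv]

theorem IsResolventOf.resolvent_identity (hR : IsResolventOf A μ R) {ν : ℝ} {R' : H →L[ℝ] H}
    (hR' : IsResolventOf A ν R') (x : H) : R x - R' x = (ν - μ) • R (R' x) := by
  have h1 := hR.left_inv ⟨R' x, hR'.mem_domain x⟩
  have h2 := hR'.right_inv x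
  have h3 : μ • R' x - A ⟨R' x, hR'.mem_domain x⟩ = x - (ν - μ) • R' x := by
    rw [eq_sub_iff_add_eq'.2 (sub_eq_iff_eq_add.1 h2).symm, sub_smul]
    abel
  rw [h3, map_sub, map_smul] at h1
  change _ = R' x at h1
  exact sub_eq_iff_eq_add.2 (sub_eq_iff_eq_add'.1 h1)

/-- Formally `R - t = -t (μ - t⁻¹ - A) R`, so the inverse is `-t⁻¹ (μ - A) R' = -t⁻¹ (1 + t⁻¹ R')`.
-/
theorem IsResolventOf.isUnit_sub (hR : IsResolventOf A μ R) {t : ℝ} (ht : t ≠ 0)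
    (hres : μ - t⁻¹ ∈ resolventSet A) : IsUnit (R - t • (1 : H →L[ℝ] H)) := by
  obtain ⟨R', hR'⟩ := hres
  have h1 : ∀ x, R x - R' x = -(t⁻¹ • R (R' x)) := fun x => by
    rw [hR.resolvent_identity hR', ← neg_smul]
    congr 1
    ring
  have h2 : ∀ x, R' x - R x = t⁻¹ • R' (R x) := fun x => by
    rw [hR'.resolvent_identity hR]
    congr 1
    ring
  rw [isUnit_iff_exists]
  refine ⟨-(t⁻¹ • (1 + t⁻¹ • R')), ?_, ?_⟩
  · ext x
    have h3 : R' x = R x + t⁻¹ • R (R' x) := by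
      rw [← sub_eq_iff_eq_add', ← neg_sub, h1, neg_neg]
    simp only [mul_apply_eq_comp, neg_apply, smul_apply, add_apply, one_apply_eq_self, sub_apply,
      map_neg, map_smul, map_add]
    generalize R (R' x) = b at *
    rw [h3]
    match_scalars <;> field_simp <;> ring
  · ext x
    have h3 : R' x = R x + t⁻¹ • R' (R x) := by rw [← sub_eq_iff_eq_add', h2]
    simp only [mul_apply_eq_comp, neg_apply, smul_apply, add_apply, one_apply_eq_self, sub_apply,
      map_smul, map_sub]
    generalize R' (R x) = b at *
    rw [h3]
    match_scalars <;> field_simp <;> ring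

/-- Near a point of the spectrum that is not an accumulation point, the resolvent minus its
eigenvalue has isolated spectrum. -/
theorem IsResolventOf.exists_isUnit_sub (hR : IsResolventOf A μ R) {l : ℝ} (hl : μ - l ≠ 0)
    (hacc : ¬ AccPt l (𝓟 (spectrum A))) :
    ∃ d > 0, ∀ s : ℝ, s ≠ 0 → |s| < d →
      IsUnit (R - (μ - l)⁻¹ • (1 : H →L[ℝ] H) - s • (1 : H →L[ℝ] H)) := by
  rw [accPt_iff_frequently_nhdsNE, not_frequently, eventually_nhdsWithin_iff] at hacc
  set κ := (μ - l)⁻¹ with hκ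
  have hκ0 : κ ≠ 0 := inv_ne_zero hl
  -- The point `κ + s` of the spectrum of `R` corresponds to `μ - (κ + s)⁻¹` for `A`, which is `l`
  -- at `s = 0`.
  have hc : ContinuousAt (fun s : ℝ => μ - (κ + s)⁻¹) 0 := by
    refine continuousAt_const.sub (ContinuousAt.inv₀ (by fun_prop) (by simpa using hκ0))
  have h0 : μ - (κ + 0)⁻¹ = l := by rw [add_zero, hκ, inv_inv]; ring
  have hev : ∀ᶠ s : ℝ in 𝓝 0, κ + s ≠ 0 ∧
      (μ - (κ + s)⁻¹ ∈ ({l}ᶜ : Set ℝ) → ¬ μ - (κ + s)⁻¹ ∈ spectrum A) := by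
    refine Eventually.and ?_ ?_
    · have h1 : ContinuousAt (fun s : ℝ => κ + s) 0 := by fun_prop
      exact h1.eventually_ne (by simpa using hκ0)
    · have h1 := hc.tendsto
      rw [h0] at h1
      exact h1.eventually hacc
  obtain ⟨d, hd, hball⟩ := Metric.eventually_nhds_iff.1 hev
  refine ⟨d, hd, fun s hs hsd => ?_⟩
  obtain ⟨h1, h2⟩ := hball (show dist s 0 < d by simpa using hsd)
  rw [sub_sub, ← add_smul]
  refine hR.isUnit_sub h1 ?_
  have h3 : μ - (κ + s)⁻¹ ∈ ({l}ᶜ : Set ℝ) := by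
    intro h4
    have h5 : μ - (κ + s)⁻¹ = μ - κ⁻¹ := by
      rw [mem_singleton_iff] at h4
      rw [h4, hκ, inv_inv]; ring
    have h6 := inv_injective (sub_right_injective h5)
    exact hs (by linarith)
  exact not_not.1 (h2 h3)

end Resolvent

/-! ### Persistence of multiplicity in terms of resolvents. -/

section ResolventPerturbation

variable {H : Type*} [NormedAddCommGroup H] [NormedSpace ℝ H]

/-- Let `v₁, v₂` be orthonormal eigenvectors of `A` for an eigenvalue `l`.  If `A'` has an eigenvalue
near `l` of the same multiplicity, then the compression of the difference of the resolvents
to `v₁, v₂` is scalar up to second order. -/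
theorem exists_bound_resolvent [CompleteSpace H] {g : H →L[ℝ] H →L[ℝ] ℝ} (hg : IsEquivInner g)
    {A : H →ₗ.[ℝ] H} (hA : IsSelfAdjointFor g A) (hspec : HasDiscreteSpectrum A) {μ l : ℝ}
    (hμ : μ ∈ resolventSet A) {v₁ v₂ : H} (hv₁ : v₁ ∈ eigenspace A l) (hv₂ : v₂ ∈ eigenspace A l)
    (h₁₁ : g v₁ v₁ = 1) (h₂₂ : g v₂ v₂ = 1) (h₁₂ : g v₁ v₂ = 0) :
    ∃ ρ > 0, ∃ r > 0, ∃ C > 0, ∀ (A' : H →ₗ.[ℝ] H) (l' : ℝ), μ ∈ resolventSet A' →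
      ‖resolvent A' μ - resolvent A μ‖ < r → |l' - l| < ρ →
      Module.finrank ℝ (eigenspace A' l') = Module.finrank ℝ (eigenspace A l) →
      |g ((resolvent A' μ - resolvent A μ) v₁) v₁ - g ((resolvent A' μ - resolvent A μ) v₂) v₂|
          ≤ C * ‖resolvent A' μ - resolvent A μ‖ ^ 2 ∧
        |g ((resolvent A' μ - resolvent A μ) v₁) v₂|
          ≤ C * ‖resolvent A' μ - resolvent A μ‖ ^ 2 := by
  have hR := isResolventOf_resolvent hμ
  set R := resolvent A μ with hRdef
  have hne : eigenspace A l ≠ ⊥ := fun h => by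
    rw [h, Submodule.mem_bot] at hv₁
    rw [hv₁, map_zero] at h₁₁
    exact zero_ne_one h₁₁
  have hls : l ∈ spectrum A := by
    rintro ⟨R', hR'⟩
    exact hR'.ne_of_eigenspace_ne_bot hne (sub_self l)
  have hl := hR.ne_of_eigenspace_ne_bot hne
  have hfin := hspec.finite_mult l hls
  have hpos : 0 < Module.finrank ℝ (eigenspace A l) :=
    Module.finrank_pos_iff.2 ((Submodule.nontrivial_iff_ne_bot).2 hne)
  obtain ⟨d, hd, hunit⟩ := hR.exists_isUnit_sub hl (hspec.no_accPt l)
  have hsymm := hR.symmetric hA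
  set κ := (μ - l)⁻¹ with hκ
  obtain ⟨P, hP, hP', hQ⟩ := hg.exists_proj_isUnit_add_of_isolated
    (S := R - κ • (1 : H →L[ℝ] H)) (fun x y => by
      simp only [sub_apply, smul_apply, one_apply_eq_self, map_sub, map_smul, hsymm]) hd hunit
  have hkerfin : FiniteDimensional ℝ
      (LinearMap.ker ((R - κ • (1 : H →L[ℝ] H) : H →L[ℝ] H) : H →ₗ[ℝ] H)) := by
    rw [← hR.eigenspace_eq_ker hl]; exact hfin
  obtain ⟨r, hr, C, hC, hbound⟩ := exists_bound_compression hsymm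
    (fun x => sub_eq_zero.1 (hP x)) (fun x hx => hP' x (sub_eq_zero.2 hx)) hQ
    ((hR.mem_eigenspace_iff hl).1 hv₁) ((hR.mem_eigenspace_iff hl).1 hv₂) h₁₁ h₂₂ h₁₂
  have hcont : ContinuousAt (fun x : ℝ => (μ - x)⁻¹) l :=
    ContinuousAt.inv₀ (by fun_prop) hl
  obtain ⟨ρ, hρ, hball⟩ := Metric.continuousAt_iff.1 hcont r hr
  refine ⟨ρ, hρ, r, hr, C, hC, fun A' l' hμ' hdiff hll hrank => ?_⟩
  have hR' := isResolventOf_resolvent hμ'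
  -- `Module.finrank` is zero in infinite dimension, so a positive value yields finiteness.
  have hpos' : 0 < Module.finrank ℝ (eigenspace A' l') := hrank ▸ hpos
  have hfin' : FiniteDimensional ℝ (eigenspace A' l') := FiniteDimensional.of_finrank_pos hpos'
  have hl' := hR'.ne_of_eigenspace_ne_bot
    ((Submodule.nontrivial_iff_ne_bot).1 (Module.finrank_pos_iff.1 hpos'))
  refine hbound (resolvent A' μ) (μ - l')⁻¹ hdiff (hball hll) ?_ ?_
  · rw [← hR'.eigenspace_eq_ker hl']; exact hfin'
  · rw [← hR'.eigenspace_eq_ker hl', ← hR.eigenspace_eq_ker hl, hrank]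

end ResolventPerturbation

/-! ### Tangency for families of operators on a manifold. -/

section Family

variable {E : Type*} [NormedAddCommGroup E] [NormedSpace ℝ E]

/-- Two linearly independent functionals take every pair of values. -/
theorem exists_eq_of_linearIndependent_pair {M : Type*} [AddCommGroup M] [Module ℝ M]
    {a b : M →ₗ[ℝ] ℝ} (h : LinearIndependent ℝ ![a, b]) (p : ℝ × ℝ) :
    ∃ x, a x = p.1 ∧ b x = p.2 := by
  by_contra hcon
  have hlt : LinearMap.range (a.prod b) < ⊤ := by
    rw [lt_top_iff_ne_top]
    intro htop
    obtain ⟨x, hx⟩ := LinearMap.range_eq_top.1 htop p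
    exact hcon ⟨x, congrArg Prod.fst hx, congrArg Prod.snd hx⟩
  obtain ⟨f, hf0, hf⟩ := Submodule.exists_le_ker_of_lt_top _ hlt
  have hfp : ∀ p : ℝ × ℝ, f p = p.1 * f (1, 0) + p.2 * f (0, 1) := fun p => by
    have : p = p.1 • ((1, 0) : ℝ × ℝ) + p.2 • ((0, 1) : ℝ × ℝ) := by ext <;> simp
    conv_lhs => rw [this, map_add, map_smul, map_smul]
    rfl
  have h0 := LinearIndependent.pair_iff.1 h (f (1, 0)) (f (0, 1)) (by
    ext x
    have h1 : f (a x, b x) = 0 := hf ⟨x, rfl⟩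
    rw [hfp] at h1
    simp only [LinearMap.add_apply, LinearMap.smul_apply, smul_eq_mul, LinearMap.zero_apply]
    linarith)
  apply hf0
  ext <;> simp [h0.1, h0.2]

/-- A normed space on which a nonempty separable space is modelled by a chart is separable. -/
theorem separableSpace_of_chart {X : Type*} [TopologicalSpace X]
    [TopologicalSpace.SeparableSpace X] (φ : OpenPartialHomeomorph X E) (hφ : φ.target.Nonempty) :
    TopologicalSpace.SeparableSpace E := by
  obtain ⟨s, hsc, hs⟩ := TopologicalSpace.exists_countable_dense X
  have hsep : TopologicalSpace.IsSeparable φ.target := by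
    refine ⟨φ '' (φ.source ∩ s), (hsc.mono inter_subset_right).image φ, fun y hy => ?_⟩
    have h1 : φ.symm y ∈ closure (φ.source ∩ s) :=
      hs.open_subset_closure_inter φ.open_source (φ.map_target hy)
    have h2 := (φ.continuousAt (φ.map_target hy)).continuousWithinAt.mem_closure_image h1
    rwa [φ.right_inv hy] at h2
  -- A nonempty open set spans `E`, and the span of a separable set is separable.
  have htop : Submodule.span ℝ φ.target = ⊤ :=
    Submodule.eq_top_of_nonempty_interior' _
      (hφ.mono (interior_maximal Submodule.subset_span φ.open_target))
  rw [← TopologicalSpace.isSeparable_univ_iff]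
  have := hsep.span (R := ℝ)
  rwa [htop, Submodule.top_coe] at this

variable {X : Type*} [TopologicalSpace X] [ChartedSpace E X]
  {H : Type*} [NormedAddCommGroup H] [NormedSpace ℝ H]

/-- In a chart, the parameters near a given one with a repeated eigenvalue for which the eigenvalue
persists with its multiplicity are tangent to a subspace of codimension two. -/
theorem exists_tangency [CompleteSpace H] [IsManifold 𝓘(ℝ, E) 1 X]
    {g : X → H →L[ℝ] H →L[ℝ] ℝ} (hg : ∀ q, IsEquivInner (g q)) {A : X → H →ₗ.[ℝ] H}
    (hA : ∀ q, IsSelfAdjointFor (g q) (A q)) (hspec : ∀ q, HasDiscreteSpectrum (A q))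
    (hres : ResolventsDifferentiable E A) (hsah : SAH2 E g A) {φ : OpenPartialHomeomorph X E}
    (hφ : φ ∈ IsManifold.maximalAtlas 𝓘(ℝ, E) 1 X) {y : E} (hy : y ∈ φ.target) {l : ℝ}
    (hl : 2 ≤ Module.rank ℝ (eigenspace (A (φ.symm y)) l)) :
    ∃ ρ > 0, ∃ L : E →L[ℝ] ℝ × ℝ, Function.Surjective L ∧
      (fun y' => L (y' - y)) =o[𝓝[{y' | ∃ l', |l' - l| < ρ ∧
        Module.finrank ℝ (eigenspace (A (φ.symm y')) l') =
          Module.finrank ℝ (eigenspace (A (φ.symm y)) l)}] y] fun y' => y' - y := by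
  obtain ⟨μ, hμ, v₁, hv₁, v₂, hv₂, h₁₁, h₂₂, h₁₂, hind⟩ := hsah (φ.symm y) l hl
  obtain ⟨ρ, hρ, r, hr, C, hC, hbound⟩ :=
    exists_bound_resolvent (hg _) (hA _) (hspec _) hμ hv₁ hv₂ h₁₁ h₂₂ h₁₂
  obtain ⟨hev, hdiff⟩ := hres (φ.symm y) μ hμ
  have hφd : φ.MDifferentiable 𝓘(ℝ, E) 𝓘(ℝ, E) :=
    ⟨fun x hx => (mdifferentiableAt_of_mem_maximalAtlas hφ hx).mdifferentiableWithinAt,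
      fun x hx => (mdifferentiableAt_symm_of_mem_maximalAtlas hφ hx).mdifferentiableWithinAt⟩
  have hsd := hφd.mdifferentiableAt_symm hy
  set F : E → H →L[ℝ] H := fun y' => resolvent (A (φ.symm y')) μ with hF
  have hFd : DifferentiableAt ℝ F y :=
    mdifferentiableAt_iff_differentiableAt.1 (hdiff.comp y hsd)
  have hF' : ∀ h : E, fderiv ℝ F y h
      = resolventDeriv E A μ (φ.symm y) (mfderiv 𝓘(ℝ, E) 𝓘(ℝ, E) φ.symm y h) := fun h => by
    rw [← mfderiv_eq_fderiv]
    exact congrArg (fun B => B h) (mfderiv_comp y hdiff hsd)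
  set q := φ.symm y with hq
  let entry : H → H → (H →L[ℝ] H) →L[ℝ] ℝ := fun v w =>
    ((g q).flip w).comp (ContinuousLinearMap.apply ℝ H v)
  let G : (H →L[ℝ] H) →L[ℝ] ℝ × ℝ :=
    (entry v₁ v₁ - entry v₂ v₂).prod (entry v₁ v₂)
  have hG : ∀ B, G B = (g q (B v₁) v₁ - g q (B v₂) v₂, g q (B v₁) v₂) := fun B => rfl
  -- This `L` is the pair of SAH2 functionals in the chart; it is onto because they are independent
  -- and the derivative of `φ.symm` is onto.
  refine ⟨ρ, hρ, G.comp (fderiv ℝ F y), fun p => ?_, ?_⟩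
  · obtain ⟨x, hx₁, hx₂⟩ := exists_eq_of_linearIndependent_pair hind p
    obtain ⟨h, hh⟩ := hφd.symm.mfderiv_surjective hy x
    have hFx : fderiv ℝ F y h = resolventDeriv E A μ q x :=
      (hF' h).trans (congrArg (resolventDeriv E A μ q) hh)
    exact ⟨h, (congrArg G hFx).trans ((hG _).trans (Prod.ext hx₁ hx₂))⟩
  · set W := {y' | ∃ l', |l' - l| < ρ ∧
        Module.finrank ℝ (eigenspace (A (φ.symm y')) l') =
          Module.finrank ℝ (eigenspace (A q) l)} with hW
    -- `L (y' - y)` is `G (F y' - F y)`, which is quadratically small on `W`, minus the image under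
    -- `G` of the Taylor remainder.
    have ho : (fun y' => G (F y' - F y - fderiv ℝ F y (y' - y))) =o[𝓝[W] y] fun y' => y' - y :=
      (G.isBigO_comp _ _).trans_isLittleO
        ((hasFDerivAt_iff_isLittleO.1 hFd.hasFDerivAt).mono nhdsWithin_le_nhds)
    have hsq : (fun y' => G (F y' - F y)) =O[𝓝[W] y] fun y' => ‖F y' - F y‖ ^ 2 := by
      refine Asymptotics.IsBigO.of_bound C ?_
      have h1 : ∀ᶠ y' in 𝓝[W] y, μ ∈ resolventSet (A (φ.symm y')) :=
        nhdsWithin_le_nhds ((φ.continuousAt_symm hy).eventually hev)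
      have h2 : ∀ᶠ y' in 𝓝[W] y, ‖F y' - F y‖ < r := by
        refine nhdsWithin_le_nhds ?_
        filter_upwards [hFd.continuousAt.eventually (Metric.ball_mem_nhds (F y) hr)] with y' h
        rwa [dist_eq_norm] at h
      filter_upwards [h1, h2, self_mem_nhdsWithin] with y' h1 h2 ⟨l', hll, hrank⟩
      obtain ⟨h3, h4⟩ := hbound (A (φ.symm y')) l' h1 h2 hll hrank
      rw [hG, Real.norm_of_nonneg (by positivity : 0 ≤ ‖F y' - F y‖ ^ 2)]
      exact max_le h3 h4
    have hsq' : (fun y' => ‖F y' - F y‖ ^ 2) =o[𝓝[W] y] fun y' => y' - y :=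
      ((hFd.hasFDerivAt.isBigO_sub.norm_norm.pow 2).trans_isLittleO
        (Asymptotics.isLittleO_pow_sub_sub y one_lt_two)).mono nhdsWithin_le_nhds
    refine ((hsq.trans_isLittleO hsq').sub ho).congr_left fun y' => ?_
    rw [← map_sub, sub_sub_cancel]
    rfl

end Family

end MeagreCodim

/-! ### The countable cover and the conclusion. -/

theorem mainTheorem4
    {E : Type*} [NormedAddCommGroup E] [NormedSpace ℝ E] [CompleteSpace E]
    {X : Type*} [TopologicalSpace X] [ChartedSpace E X] [TopologicalSpace.SeparableSpace X]
    (k : WithTop ℕ∞) (hk : 1 ≤ k) [IsManifold 𝓘(ℝ, E) k X]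
    {H : Type*} [NormedAddCommGroup H] [NormedSpace ℝ H] [CompleteSpace H]
    (g : X → H →L[ℝ] H →L[ℝ] ℝ)
    (hg_inner : ∀ q, MeagreCodim.IsEquivInner (g q))
    (hg_diff : MDifferentiable 𝓘(ℝ, E) 𝓘(ℝ, H →L[ℝ] H →L[ℝ] ℝ) g)
    (A : X → H →ₗ.[ℝ] H)
    (hA_domain : ∀ p q, (A p).domain = (A q).domain)
    (hA_selfAdjoint : ∀ q, MeagreCodim.IsSelfAdjointFor (g q) (A q))
    (hA_spectrum : ∀ q, MeagreCodim.HasDiscreteSpectrum (A q))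
    (hA_resolvent : MeagreCodim.ResolventsDifferentiable E A)
    (hA_SAH2 : MeagreCodim.SAH2 E g A) :
    MeagreCodim.HasMeagreCodim E k {q : X | MeagreCodim.HasRepeatedEigenvalue (A q)} 2 := by
  intro φ hφ m hm Z π hπ
  obtain rfl : m = 1 := by omega
  -- Separability of `E` is derived from a nonempty chart, so an empty one is treated apart.
  rcases φ.target.eq_empty_or_nonempty with hempty | hne
  · have : φ '' (φ.source ∩ {q : X | MeagreCodim.HasRepeatedEigenvalue (A q)}) = ∅ := by
      rw [← subset_empty_iff, ← hempty]
      rintro _ ⟨x, hx, rfl⟩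
      exact φ.map_source hx.1
    rw [this, image_empty]
    exact IsMeagre.empty
  have : IsManifold 𝓘(ℝ, E) 1 X := IsManifold.of_le hk
  have hφ₁ := IsManifold.maximalAtlas_subset_of_le hk hφ
  have : TopologicalSpace.SeparableSpace E := MeagreCodim.separableSpace_of_chart φ hne
  have : SecondCountableTopology E := UniformSpace.secondCountable_of_separable E
  have : CompleteSpace Z := hπ.isClosed.completeSpace_coe
  have hmem : ∀ y ∈ φ '' (φ.source ∩ {q : X | MeagreCodim.HasRepeatedEigenvalue (A q)}),
      y ∈ φ.target ∧ MeagreCodim.HasRepeatedEigenvalue (A (φ.symm y)) := by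
    rintro _ ⟨x, ⟨hx, hxA⟩, rfl⟩
    exact ⟨φ.map_source hx, by rwa [φ.left_inv hx]⟩
  refine MeagreCodim.isMeagre_image_of_tangency (f' := fun y => fderiv ℝ π y)
    (W := fun i : ℕ × ℚ × ℚ => {y | ∃ l : ℝ, |l - i.2.1| < i.2.2 ∧
      Module.finrank ℝ (MeagreCodim.eigenspace (A (φ.symm y)) l) = i.1})
    (fun y hy => ?_) (fun y hy => (hπ.differentiableAt y (hmem y hy).1).hasFDerivAt)
    (fun y hy => hπ.surjective y (hmem y hy).1) (fun y hy => ?_)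
  · obtain ⟨hyt, l, hl⟩ := hmem y hy
    obtain ⟨ρ, hρ, L, hL, ho⟩ := MeagreCodim.exists_tangency hg_inner hA_selfAdjoint hA_spectrum
      hA_resolvent hA_SAH2 hφ₁ hyt hl
    -- Two points of an interval of radius `s < ρ / 2` about `a` are within `ρ`, so this `W i` lies
    -- in the set of `exists_tangency`.
    obtain ⟨s, hs0, hsρ⟩ := exists_rat_btwn (half_pos hρ)
    obtain ⟨a, hal, has⟩ := exists_rat_btwn (lt_add_of_pos_right l hs0)
    refine ⟨(Module.finrank ℝ (MeagreCodim.eigenspace (A (φ.symm y)) l), a, s),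
      ⟨l, by rw [abs_lt]; constructor <;> linarith, rfl⟩, L, hL,
      ho.mono (nhdsWithin_mono y ?_)⟩
    rintro y' ⟨l', hl', hrank⟩
    refine ⟨l', ?_, hrank⟩
    rw [abs_lt] at hl' ⊢
    constructor <;> linarith
  · obtain ⟨e, he, hspan⟩ := rank_eq_one_iff.1 ((hπ.rank_ker y (hmem y hy).1).trans Nat.cast_one)
    refine ⟨e, fun h => he (Subtype.ext h), fun x hx => ?_⟩
    obtain ⟨c, hc⟩ := hspan ⟨x, hx⟩
    exact ⟨c, congrArg Subtype.val hc⟩
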